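/- Let $k$ be a field and let $H$ be a co-Frobenius Hopf algebra over $k$, that is, a Hopf algebra with a nonzero left integral $\Lambda : H \to k$, $h_1\Lambda(h_2) = \Lambda(h)1$ for all $h \in H$. Let $S$ be the antipode of $H$, and let $\mathcal{M}^H$ be the category of right $H$-comodules $(M,\rho)$. The stable category $\underline{\mathcal{M}}^H$ has the same objects, and its morphisms are colinear maps modulo those that factor through an injective comodule. For a comodule $M$, let $T(M) = (M\otimes H)/\rho(M)$, where $M \otimes H$ has the coaction $\mathrm{id}\otimes\Delta$, and let $T'(M) = M\otimes \ker(\Lambda\circ S)$ with the diagonal coaction, where $\ker(\Lambda\circ S)$ is a right subcomodule of $H$. The functor $T$ descends to $\underline{\mathcal{M}}^H$. For a colinear map $f : A\to B$ let $Co(f)$ be the pushout of $\rho : A\to A\otimes H$ and $f$, with the map $Co(f)\to T(A)$ that is the canonical projection on $A\otimes H$ and zero on $B$. A sequence $X\to Y\to Z\to TX$ in $\underline{\mathcal{M}}^H$ is a distinguished triangle if it is isomorphic in $\underline{\mathcal{M}}^H$ to a sequence $A\xrightarrow{f} B\to Co(f)\to T(A)$ of this form. Put $M^{coH}=\{m\in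 M : \rho(m) = m\otimes 1\}$, $\Lambda\cdot m = \Lambda(m_1)m_0$, and $$H_0^H(M) = M^{coH}/\Lambda\cdot M,\qquad H_{-n}^H(M) = H_0^H(T^nM),\qquad H_n^H(M) = H_0^H(T'^nM)\qquad (n\ge 0).$$ Then every $H_n^H$ ($n\in\mathbb{Z}$) takes equal values on colinear maps whose difference factors through an injective comodule, and so defines a functor from $\underline{\mathcal{M}}^H$ to $k$-vector spaces; this functor is additive. There are natural isomorphisms $\theta_n : H_{n+1}^H\circ T\cong H_n^H$ of functors on $\underline{\mathcal{M}}^H$ for all $n \in \mathbb{Z}$, such that for every distinguished triangle $X\xrightarrow{f} Y\xrightarrow{g} Z\xrightarrow{h} TX$ the sequence of vector spaces $$\cdots\to H_{n+1}^H(Y)\xrightarrow{g_*} H_{n+1}^H(Z)\xrightarrow{\partial} H_n^H(X)\xrightarrow{f_*} H_n^H(Y)\xrightarrow{g_*} H_n^H(Z)\xrightarrow{\partial} H_{n-1}^H(X)\to\cdots,\qquad \partial = \theta_n\circ h_*,$$ is exact (where $\theta_n$ is taken at $X$). In particular every $H_n^H$ is a homological functor on $\underline{\mathcal{M}}^H$.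 -/

import Mathlib

universe u v

open CategoryTheory TensorProduct

noncomputable section

namespace CoFrobenius

variable {k : Type u} {H : Type v} [Field k] [Ring H] [HopfAlgebra k H]

/-! ## Right comodules -/

variable (k H) in
/-- A right `H`-comodule `(M, ρ : M → M ⊗ H)`. -/
structure Comod where
  carrier : Type v
  [addCommGroup : AddCommGroup carrier]
  [module : Module k carrier]
  coact : carrier →ₗ[k] carrier ⊗[k] H
  coassoc : ∀ m, TensorProduct.assoc k carrier H H (coact.rTensor H (coact m)) =
    (Coalgebra.comul (R := k) (A := H)).lTensor carrier (coact m)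
  counit : ∀ m, TensorProduct.rid k carrier
    ((Coalgebra.counit (R := k) (A := H)).lTensor carrier (coact m)) = m

attribute [instance] Comod.addCommGroup Comod.module

namespace Comod

/-- Colinear maps. -/
@[ext]
structure Hom (M N : Comod k H) where
  lin : M.carrier →ₗ[k] N.carrier
  colinear : ∀ m, lin.rTensor H (M.coact m) = N.coact (lin m)

instance : Category (Comod k H) where
  Hom := Hom
  id M := ⟨LinearMap.id, fun m => by simp⟩
  comp f g := ⟨g.lin ∘ₗ f.lin, fun m => by
    rw [LinearMap.rTensor_comp_apply, f.colinear, g.colinear]; rfl⟩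

@[ext]
theorem hom_ext {M N : Comod k H} {f g : M ⟶ N} (h : ∀ m, f.lin m = g.lin m) : f = g :=
  Hom.ext (LinearMap.ext h)

@[simp] theorem id_lin (M : Comod k H) (m : M.carrier) : (𝟙 M : M ⟶ M).lin m = m := rfl

@[simp] theorem comp_lin {M N P : Comod k H} (f : M ⟶ N) (g : N ⟶ P) (m : M.carrier) :
    (f ≫ g).lin m = g.lin (f.lin m) := rfl

instance (M N : Comod k H) : Zero (M ⟶ N) := ⟨⟨0, fun m => by simp⟩⟩

instance (M N : Comod k H) : Add (M ⟶ N) :=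
  ⟨fun f g => ⟨f.lin + g.lin, fun m => by
    simp [LinearMap.rTensor_add, f.colinear, g.colinear]⟩⟩

instance (M N : Comod k H) : Neg (M ⟶ N) :=
  ⟨fun f => ⟨-f.lin, fun m => by simp [LinearMap.rTensor_neg, f.colinear]⟩⟩

@[simp] theorem zero_lin {M N : Comod k H} (m : M.carrier) : (0 : M ⟶ N).lin m = 0 := rfl

@[simp] theorem add_lin {M N : Comod k H} (f g : M ⟶ N) (m : M.carrier) :
    (f + g).lin m = f.lin m + g.lin m := rfl

@[simp] theorem neg_lin {M N : Comod k H} (f : M ⟶ N) (m : M.carrier) :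
    (-f).lin m = -f.lin m := rfl

instance : Preadditive (Comod k H) where
  homGroup M N :=
    { add_assoc := fun f g h => by ext; simp [add_assoc]
      zero_add := fun f => by ext; simp
      add_zero := fun f => by ext; simp
      add_comm := fun f g => by ext; simp [add_comm]
      neg_add_cancel := fun f => by ext; simp
      nsmul := nsmulRec
      zsmul := zsmulRec }
  add_comp := fun _ _ _ f g h => by ext; simp
  comp_add := fun _ _ _ f g h => by ext; simp

@[simp] theorem sub_lin {M N : Comod k H} (f g : M ⟶ N) (m : M.carrier) :
    (f - g).lin m = f.lin m - g.lin m := by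
  rw [sub_eq_add_neg, sub_eq_add_neg]; rfl

/-! ### Subcomodules, quotients, products -/

theorem rTensor_subtype_injective {M : Type v} [AddCommGroup M] [Module k M] (N : Submodule k M)
    (A : Type v) [AddCommGroup A] [Module k A] :
    Function.Injective (N.subtype.rTensor A) :=
  Module.Flat.rTensor_preserves_injective_linearMap _ N.injective_subtype

/-- The restriction of a coaction `ρ` to a subspace `N` with `ρ(N) ⊆ N ⊗ H`. -/
def subCoact (M : Comod k H) (N : Submodule k M.carrier)
    (hN : ∀ n ∈ N, M.coact n ∈ LinearMap.range (N.subtype.rTensor H)) : N →ₗ[k] N ⊗[k] H :=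
  (LinearEquiv.ofInjective (N.subtype.rTensor H) (rTensor_subtype_injective N H)).symm.toLinearMap ∘ₗ
    (M.coact ∘ₗ N.subtype).codRestrict _ (fun n => hN n n.2)

theorem rTensor_subCoact (M : Comod k H) (N : Submodule k M.carrier)
    (hN : ∀ n ∈ N, M.coact n ∈ LinearMap.range (N.subtype.rTensor H)) (n : N) :
    N.subtype.rTensor H (M.subCoact N hN n) = M.coact n := by
  exact LinearEquiv.ofInjective_symm_apply (N.subtype.rTensor H)
    (h := rTensor_subtype_injective N H)
    ((M.coact ∘ₗ N.subtype).codRestrict _ (fun n => hN n n.2) n)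

/-- The subcomodule on a subspace `N` with `ρ(N) ⊆ N ⊗ H`. -/
def sub (M : Comod k H) (N : Submodule k M.carrier)
    (hN : ∀ n ∈ N, M.coact n ∈ LinearMap.range (N.subtype.rTensor H)) : Comod k H where
  carrier := N
  coact := M.subCoact N hN
  coassoc n := by
    apply rTensor_subtype_injective N (H ⊗[k] H)
    have h1 : ∀ x : (N ⊗[k] H) ⊗[k] H, N.subtype.rTensor (H ⊗[k] H) (TensorProduct.assoc k N H H x) =
        TensorProduct.assoc k M.carrier H H ((N.subtype.rTensor H).rTensor H x) := by
      intro x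
      rw [LinearMap.rTensor_tensor]; simp
    have h2 : ∀ x : N ⊗[k] H, N.subtype.rTensor (H ⊗[k] H) (Coalgebra.comul.lTensor N x) =
        Coalgebra.comul.lTensor M.carrier (N.subtype.rTensor H x) := by
      intro x
      rw [← LinearMap.comp_apply, ← LinearMap.comp_apply, LinearMap.rTensor_comp_lTensor,
        LinearMap.lTensor_comp_rTensor]
    have h3 : N.subtype.rTensor H ∘ₗ M.subCoact N hN = M.coact ∘ₗ N.subtype :=
      LinearMap.ext (M.rTensor_subCoact N hN)
    rw [h1, h2, rTensor_subCoact, ← LinearMap.rTensor_comp_apply, h3, LinearMap.rTensor_comp_apply,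
      rTensor_subCoact, M.coassoc]
  counit n := by
    apply N.injective_subtype
    have h2 : ∀ x : N ⊗[k] H, N.subtype (TensorProduct.rid k N
        ((Coalgebra.counit (R := k)).lTensor N x)) =
        TensorProduct.rid k M.carrier (Coalgebra.counit.lTensor M.carrier (N.subtype.rTensor H x)) := by
      intro x
      induction x with
      | zero => simp
      | tmul a b => simp
      | add a b ha hb => simp only [map_add, ha, hb]
    rw [h2, rTensor_subCoact, M.counit]; rfl

/-- The inclusion of a subcomodule. -/
def subι (M : Comod k H) (N : Submodule k M.carrier)
    (hN : ∀ n ∈ N, M.coact n ∈ LinearMap.range (N.subtype.rTensor H)) : M.sub N hN ⟶ M :=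
  ⟨N.subtype, M.rTensor_subCoact N hN⟩

theorem injective_of_mono {M N : Comod k H} (f : M ⟶ N) [Mono f] : Function.Injective f.lin := by
  rw [← LinearMap.ker_eq_bot, eq_bot_iff]
  intro m hm
  have hK : ∀ n ∈ LinearMap.ker f.lin,
      M.coact n ∈ LinearMap.range ((LinearMap.ker f.lin).subtype.rTensor H) := by
    intro n hn
    have hex : Function.Exact ((LinearMap.ker f.lin).subtype.rTensor H) (f.lin.rTensor H) :=
      Module.Flat.rTensor_exact H (LinearMap.exact_subtype_ker_map _)
    apply (hex _).1
    rw [f.colinear, LinearMap.mem_ker.1 hn, map_zero]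
  have h0 : M.subι _ hK ≫ f = 0 ≫ f :=
    Hom.ext (LinearMap.ext fun x => (LinearMap.mem_ker.1 x.2).trans (map_zero f.lin).symm)
  have h : M.subι _ hK = 0 := (cancel_mono f).1 h0
  exact congrArg (fun g : M.sub _ hK ⟶ M => g.lin ⟨m, hm⟩) h

theorem mono_of_injective {M N : Comod k H} (f : M ⟶ N) (hf : Function.Injective f.lin) :
    Mono f :=
  ⟨fun g h e => by
    ext x
    exact hf (congrArg (fun q => q.lin x) e)⟩

/-- The cokernel `N / f(M)` of a colinear map `f : M → N`. -/
def coker {M N : Comod k H} (f : M ⟶ N) : Comod k H where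
  carrier := N.carrier ⧸ LinearMap.range f.lin
  coact := (LinearMap.range f.lin).liftQ
    ((LinearMap.range f.lin).mkQ.rTensor H ∘ₗ N.coact) (by
      rintro _ ⟨m, rfl⟩
      have h : (LinearMap.range f.lin).mkQ ∘ₗ f.lin = 0 := LinearMap.range_mkQ_comp _
      rw [LinearMap.mem_ker, LinearMap.comp_apply, ← f.colinear, ← LinearMap.rTensor_comp_apply, h]
      simp)
  coassoc n := by
    obtain ⟨n, rfl⟩ := Submodule.mkQ_surjective _ n
    set q := (LinearMap.range f.lin).mkQ with hq
    have h1 : ∀ x : (N.carrier ⊗[k] H) ⊗[k] H, q.rTensor (H ⊗[k] H) (TensorProduct.assoc k _ H H x) =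
        TensorProduct.assoc k _ H H ((q.rTensor H).rTensor H x) := by
      intro x
      rw [LinearMap.rTensor_tensor]; simp
    have h2 : ∀ x : N.carrier ⊗[k] H, q.rTensor (H ⊗[k] H) (Coalgebra.comul.lTensor _ x) =
        Coalgebra.comul.lTensor _ (q.rTensor H x) := by
      intro x
      rw [← LinearMap.comp_apply, ← LinearMap.comp_apply, LinearMap.rTensor_comp_lTensor,
        LinearMap.lTensor_comp_rTensor]
    simp only [Submodule.mkQ_apply, Submodule.liftQ_apply, LinearMap.comp_apply]
    simp only [← hq]
    rw [← LinearMap.rTensor_comp_apply, ← h2, ← N.coassoc, h1, ← LinearMap.rTensor_comp_apply]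
    congr 2
  counit n := by
    obtain ⟨n, rfl⟩ := Submodule.mkQ_surjective _ n
    set q := (LinearMap.range f.lin).mkQ with hq
    have h2 : ∀ x : N.carrier ⊗[k] H, q (TensorProduct.rid k _
        ((Coalgebra.counit (R := k)).lTensor _ x)) =
        TensorProduct.rid k _ (Coalgebra.counit.lTensor _ (q.rTensor H x)) := by
      intro x
      induction x with
      | zero => simp
      | tmul a b => simp
      | add a b ha hb => simp only [map_add, ha, hb]
    conv_rhs => rw [← N.counit n, h2]
    rfl

/-- The projection `N → N / f(M)`. -/
def cokerπ {M N : Comod k H} (f : M ⟶ N) : N ⟶ coker f :=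
  ⟨(LinearMap.range f.lin).mkQ, fun _ => rfl⟩

/-- The map `N / f(M) → P` induced by `g : N → P` with `g ∘ f = 0`. -/
def cokerDesc {M N P : Comod k H} (f : M ⟶ N) (g : N ⟶ P) (h : f ≫ g = 0) : coker f ⟶ P :=
  have hle : LinearMap.range f.lin ≤ LinearMap.ker g.lin := by
    rintro _ ⟨m, rfl⟩
    exact congrArg (fun q => q.lin m) h
  ⟨(LinearMap.range f.lin).liftQ g.lin hle, fun n => by
    obtain ⟨n, rfl⟩ := Submodule.mkQ_surjective _ n
    have h1 : (LinearMap.range f.lin).liftQ g.lin hle ∘ₗ (LinearMap.range f.lin).mkQ = g.lin :=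
      Submodule.liftQ_mkQ _ _ _
    change _ = P.coact (g.lin n)
    rw [← g.colinear]
    conv_rhs => rw [← h1, LinearMap.rTensor_comp_apply]
    rfl⟩

@[simp] theorem coker_condition {M N : Comod k H} (f : M ⟶ N) : f ≫ cokerπ f = 0 := by
  ext m
  exact (Submodule.Quotient.mk_eq_zero _).2 ⟨m, rfl⟩

@[simp] theorem cokerπ_desc {M N P : Comod k H} (f : M ⟶ N) (g : N ⟶ P) (h : f ≫ g = 0) :
    cokerπ f ≫ cokerDesc f g h = g := rfl

theorem coker_hom_ext {M N P : Comod k H} {f : M ⟶ N} {g h : coker f ⟶ P}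
    (e : cokerπ f ≫ g = cokerπ f ≫ h) : g = h := by
  ext n
  obtain ⟨n, rfl⟩ := Submodule.mkQ_surjective _ n
  exact congrArg (fun q => q.lin n) e

/-- The coaction of `M ⊕ N`. -/
def prodCoact (M N : Comod k H) :
    M.carrier × N.carrier →ₗ[k] (M.carrier × N.carrier) ⊗[k] H :=
  ((LinearMap.inl k M.carrier N.carrier).rTensor H ∘ₗ M.coact).coprod
    ((LinearMap.inr k M.carrier N.carrier).rTensor H ∘ₗ N.coact)

/-- The direct sum of two comodules. -/
def prod (M N : Comod k H) : Comod k H where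
  carrier := M.carrier × N.carrier
  coact := prodCoact M N
  coassoc x := by
    obtain ⟨m, n⟩ := x
    have h1 : ∀ {A B : Type v} [AddCommGroup A] [Module k A] [AddCommGroup B] [Module k B]
        (q : A →ₗ[k] B) (x : (A ⊗[k] H) ⊗[k] H), TensorProduct.assoc k _ H H ((q.rTensor H).rTensor H x)
          = q.rTensor (H ⊗[k] H) (TensorProduct.assoc k _ H H x) := by
      intro A B _ _ _ _ q x
      rw [LinearMap.rTensor_tensor]; simp
    have h2 : ∀ {A B : Type v} [AddCommGroup A] [Module k A] [AddCommGroup B] [Module k B]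
        (q : A →ₗ[k] B) (x : A ⊗[k] H), (Coalgebra.comul (R := k)).lTensor _ (q.rTensor H x) =
          q.rTensor (H ⊗[k] H) (Coalgebra.comul.lTensor _ x) := by
      intro A B _ _ _ _ q x
      rw [← LinearMap.comp_apply, ← LinearMap.comp_apply, LinearMap.rTensor_comp_lTensor,
        LinearMap.lTensor_comp_rTensor]
    simp only [prodCoact, LinearMap.coprod_apply, LinearMap.comp_apply, map_add]
    rw [← LinearMap.rTensor_comp_apply, ← LinearMap.rTensor_comp_apply, LinearMap.coprod_inl,
      LinearMap.coprod_inr, LinearMap.rTensor_comp_apply, LinearMap.rTensor_comp_apply,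
      h1, h1, h2, h2, M.coassoc, N.coassoc]
  counit x := by
    obtain ⟨m, n⟩ := x
    have h2 : ∀ {A B : Type v} [AddCommGroup A] [Module k A] [AddCommGroup B] [Module k B]
        (q : A →ₗ[k] B) (x : A ⊗[k] H), TensorProduct.rid k _
        ((Coalgebra.counit (R := k)).lTensor _ (q.rTensor H x)) =
        q (TensorProduct.rid k _ (Coalgebra.counit.lTensor _ x)) := by
      intro A B _ _ _ _ q x
      induction x with
      | zero => simp
      | tmul a b => simp
      | add a b ha hb => simp only [map_add, ha, hb]
    simp only [prodCoact, LinearMap.coprod_apply, LinearMap.comp_apply, map_add]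
    rw [h2, h2, M.counit, N.counit]
    simp

/-- The inclusion of the first summand. -/
def inl (M N : Comod k H) : M ⟶ prod M N :=
  ⟨LinearMap.inl k M.carrier N.carrier, fun m => by
    have e : (LinearMap.inl k M.carrier N.carrier).rTensor H (M.coact m) =
        prodCoact M N (LinearMap.inl k M.carrier N.carrier m) := by simp [prodCoact]
    exact e⟩

/-- The inclusion of the second summand. -/
def inr (M N : Comod k H) : N ⟶ prod M N :=
  ⟨LinearMap.inr k M.carrier N.carrier, fun m => by
    have e : (LinearMap.inr k M.carrier N.carrier).rTensor H (N.coact m) =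
        prodCoact M N (LinearMap.inr k M.carrier N.carrier m) := by simp [prodCoact]
    exact e⟩

/-- The map `M ⊕ N → P` with components `f` and `g`. -/
def coprod {M N P : Comod k H} (f : M ⟶ P) (g : N ⟶ P) : prod M N ⟶ P :=
  ⟨f.lin.coprod g.lin, fun x => by
    have e : ∀ x : M.carrier × N.carrier, (f.lin.coprod g.lin).rTensor H (prodCoact M N x) =
        P.coact (f.lin.coprod g.lin x) := by
      intro x
      simp only [prodCoact, LinearMap.coprod_apply, LinearMap.comp_apply, map_add]
      rw [← LinearMap.rTensor_comp_apply, ← LinearMap.rTensor_comp_apply, LinearMap.coprod_inl,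
        LinearMap.coprod_inr, f.colinear, g.colinear]
    exact e x⟩

@[simp] theorem inl_coprod {M N P : Comod k H} (f : M ⟶ P) (g : N ⟶ P) :
    inl M N ≫ coprod f g = f :=
  Hom.ext (LinearMap.coprod_inl f.lin g.lin)

@[simp] theorem inr_coprod {M N P : Comod k H} (f : M ⟶ P) (g : N ⟶ P) :
    inr M N ≫ coprod f g = g :=
  Hom.ext (LinearMap.coprod_inr f.lin g.lin)

theorem prod_hom_ext {M N P : Comod k H} {f g : prod M N ⟶ P} (h₁ : inl M N ≫ f = inl M N ≫ g)
    (h₂ : inr M N ≫ f = inr M N ≫ g) : f = g :=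
  Hom.ext (LinearMap.prod_ext (congrArg Hom.lin h₁) (congrArg Hom.lin h₂))

/-! ### Cofree comodules -/

variable (k H) in
/-- The coaction `id ⊗ Δ` on `V ⊗ H`. -/
def cofreeCoact (V : Type v) [AddCommGroup V] [Module k V] :
    V ⊗[k] H →ₗ[k] (V ⊗[k] H) ⊗[k] H :=
  (TensorProduct.assoc k V H H).symm.toLinearMap ∘ₗ Coalgebra.comul.lTensor V

theorem cofreeCoact_natural {V W : Type v} [AddCommGroup V] [Module k V] [AddCommGroup W]
    [Module k W] (ψ : V →ₗ[k] W) (x : V ⊗[k] H) :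
    cofreeCoact k H W (ψ.rTensor H x) = (ψ.rTensor H).rTensor H (cofreeCoact k H V x) := by
  induction x with
  | zero => simp
  | add a b ha hb => simp only [map_add, ha, hb]
  | tmul a b =>
    simp only [cofreeCoact, LinearMap.comp_apply, LinearMap.rTensor_tmul, LinearMap.lTensor_tmul,
      LinearEquiv.coe_coe]
    generalize (Coalgebra.comul (R := k) b) = y
    induction y with
    | zero => simp
    | add a b ha hb => simp only [map_add, tmul_add, ha, hb]
    | tmul c d => simp

variable (k H) in
/-- `V ⊗ H` with the coaction `id ⊗ Δ`. -/
def cofree (V : Type v) [AddCommGroup V] [Module k V] : Comod k H where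
  carrier := V ⊗[k] H
  coact := cofreeCoact k H V
  coassoc m := by
    unfold cofreeCoact
    induction m with
    | zero => simp
    | add a b ha hb => simp only [map_add, ha, hb]
    | tmul w h =>
      have key := Coalgebra.coassoc_apply (R := k) h
      simp only [LinearMap.comp_apply, LinearMap.lTensor_tmul, LinearEquiv.coe_coe]
      have e1 : ∀ x : H ⊗[k] H, TensorProduct.assoc k (V ⊗[k] H) H H
          (((TensorProduct.assoc k V H H).symm.toLinearMap ∘ₗ Coalgebra.comul.lTensor V).rTensor H
            ((TensorProduct.assoc k V H H).symm (w ⊗ₜ x))) =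
          (TensorProduct.assoc k V H (H ⊗[k] H)).symm (w ⊗ₜ
            TensorProduct.assoc k H H H (Coalgebra.comul.rTensor H x)) := by
        intro x
        induction x with
        | zero => simp
        | add a b ha hb => simp only [map_add, tmul_add, ha, hb]
        | tmul a b =>
          simp only [assoc_symm_tmul, LinearMap.rTensor_tmul, LinearMap.comp_apply,
            LinearMap.lTensor_tmul, LinearEquiv.coe_coe]
          generalize (Coalgebra.comul (R := k) a) = y
          induction y with
          | zero => simp
          | add a b ha hb => simp only [map_add, tmul_add, add_tmul, ha, hb]
          | tmul c d => simp
      have e2 : ∀ x : H ⊗[k] H, Coalgebra.comul.lTensor (V ⊗[k] H)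
            ((TensorProduct.assoc k V H H).symm (w ⊗ₜ x)) =
          (TensorProduct.assoc k V H (H ⊗[k] H)).symm (w ⊗ₜ
            (Coalgebra.comul (R := k)).lTensor H x) := by
        intro x
        induction x with
        | zero => simp
        | add a b ha hb => simp only [map_add, tmul_add, ha, hb]
        | tmul a b => simp
      rw [e1, e2, key]
  counit m := by
    unfold cofreeCoact
    induction m with
    | zero => simp
    | add a b ha hb => simp only [map_add, ha, hb]
    | tmul w h =>
      have key := Coalgebra.lTensor_counit_comul (R := k) h
      simp only [LinearMap.comp_apply, LinearMap.lTensor_tmul, LinearEquiv.coe_coe]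
      have e : ∀ x : H ⊗[k] H, TensorProduct.rid k (V ⊗[k] H) (Coalgebra.counit.lTensor (V ⊗[k] H)
            ((TensorProduct.assoc k V H H).symm (w ⊗ₜ x))) =
          w ⊗ₜ TensorProduct.rid k H ((Coalgebra.counit (R := k)).lTensor H x) := by
        intro x
        induction x with
        | zero => simp
        | add a b ha hb => simp only [map_add, tmul_add, ha, hb]
        | tmul a b => simp
      rw [e, key]; simp

/-- The colinear map `(ψ ⊗ id) ρ : Y → V ⊗ H` attached to a linear map `ψ : Y → V`. -/
def cofreeLift {V : Type v} [AddCommGroup V] [Module k V] (Y : Comod k H)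
    (ψ : Y.carrier →ₗ[k] V) : Y ⟶ cofree k H V :=
  ⟨ψ.rTensor H ∘ₗ Y.coact, fun m => by
    have e : (ψ.rTensor H ∘ₗ Y.coact).rTensor H (Y.coact m) =
        cofreeCoact k H V (ψ.rTensor H (Y.coact m)) := by
      rw [cofreeCoact_natural, cofreeCoact, LinearMap.comp_apply, ← Y.coassoc, LinearEquiv.coe_coe,
        LinearEquiv.symm_apply_apply, LinearMap.rTensor_comp_apply]
    exact e⟩

theorem cofreeLift_counit {V : Type v} [AddCommGroup V] [Module k V] {X : Comod k H}
    (g : X ⟶ cofree k H V) :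
    cofreeLift X ((TensorProduct.rid k V).toLinearMap ∘ₗ Coalgebra.counit.lTensor V ∘ₗ g.lin) = g := by
  have e : ∀ g' : X.carrier →ₗ[k] V ⊗[k] H,
      (∀ m, g'.rTensor H (X.coact m) = cofreeCoact k H V (g' m)) →
      ((TensorProduct.rid k V).toLinearMap ∘ₗ Coalgebra.counit.lTensor V ∘ₗ g').rTensor H ∘ₗ
        X.coact = g' := by
    intro g' hg
    ext x
    rw [LinearMap.comp_apply, ← LinearMap.comp_assoc, LinearMap.rTensor_comp_apply, hg]
    generalize g' x = y
    induction y with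
    | zero => simp
    | add a b ha hb => simp only [map_add, ha, hb]
    | tmul w h =>
      have key := Coalgebra.rTensor_counit_comul (R := k) h
      simp only [cofreeCoact, LinearMap.comp_apply, LinearMap.lTensor_tmul, LinearEquiv.coe_coe]
      have e : ∀ x : H ⊗[k] H, ((TensorProduct.rid k V).toLinearMap ∘ₗ
          (Coalgebra.counit (R := k)).lTensor V).rTensor H
            ((TensorProduct.assoc k V H H).symm (w ⊗ₜ x)) =
          w ⊗ₜ TensorProduct.lid k H ((Coalgebra.counit (R := k)).rTensor H x) := by
        intro x
        induction x with
        | zero => simp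
        | add a b ha hb => simp only [map_add, tmul_add, ha, hb]
        | tmul a b => simp [smul_tmul]
      rw [e, key]; simp
  exact Hom.ext (e g.lin g.colinear)

instance cofree_injective (V : Type v) [AddCommGroup V] [Module k V] :
    Injective (cofree k H V) where
  factors {X Y} g f _ := by
    obtain ⟨r, hr⟩ := LinearMap.exists_leftInverse_of_injective f.lin
      (LinearMap.ker_eq_bot.2 (injective_of_mono f))
    refine ⟨cofreeLift Y (((TensorProduct.rid k V).toLinearMap ∘ₗ
      Coalgebra.counit.lTensor V ∘ₗ g.lin) ∘ₗ r), ?_⟩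
    have e : ∀ φ : X.carrier →ₗ[k] V, f ≫ cofreeLift Y (φ ∘ₗ r) = cofreeLift X φ := by
      intro φ
      refine Hom.ext (LinearMap.ext fun x => ?_)
      change (φ ∘ₗ r).rTensor H (Y.coact (f.lin x)) = φ.rTensor H (X.coact x)
      rw [← f.colinear, ← LinearMap.rTensor_comp_apply, LinearMap.comp_assoc, hr,
        LinearMap.comp_id]
    exact (e _).trans (cofreeLift_counit g)

/-- The coaction as a colinear embedding `ρ : M → M ⊗ H` into the cofree comodule. -/
def coactHom (M : Comod k H) : M ⟶ cofree k H M.carrier :=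
  cofreeLift M LinearMap.id

@[simp] theorem coactHom_lin (M : Comod k H) (m : M.carrier) : M.coactHom.lin m = M.coact m :=
  LinearMap.congr_fun (LinearMap.rTensor_id H M.carrier) (M.coact m)

instance (M : Comod k H) : Mono M.coactHom :=
  mono_of_injective _ fun a b h => by
    rw [coactHom_lin, coactHom_lin] at h
    rw [← M.counit a, h, M.counit]

/-- The map `f ⊗ id : M ⊗ H → N ⊗ H`. -/
def cofreeMap {M N : Comod k H} (f : M ⟶ N) : cofree k H M.carrier ⟶ cofree k H N.carrier :=
  ⟨f.lin.rTensor H, fun x => (cofreeCoact_natural f.lin x).symm⟩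

theorem coactHom_naturality {M N : Comod k H} (f : M ⟶ N) :
    M.coactHom ≫ cofreeMap f = f ≫ N.coactHom := by
  refine Hom.ext (LinearMap.ext fun m => ?_)
  have e := f.colinear m
  rw [← coactHom_lin, ← coactHom_lin] at e
  exact e

/-! ### Tensor products -/

/-- The map `(M ⊗ A) ⊗ (N ⊗ A) → (M ⊗ N) ⊗ A` sending `(m ⊗ a) ⊗ (n ⊗ b)` to `(m ⊗ n) ⊗ ab`. -/
def mulTensor (M N A : Type v) [AddCommGroup M] [Module k M] [AddCommGroup N] [Module k N]
    [Ring A] [Algebra k A] : (M ⊗[k] A) ⊗[k] (N ⊗[k] A) →ₗ[k] (M ⊗[k] N) ⊗[k] A :=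
  (LinearMap.mul' k A).lTensor (M ⊗[k] N) ∘ₗ
    (TensorProduct.tensorTensorTensorComm k M A N A).toLinearMap

@[simp] theorem mulTensor_tmul {M N A : Type v} [AddCommGroup M] [Module k M] [AddCommGroup N]
    [Module k N] [Ring A] [Algebra k A] (m : M) (n : N) (a b : A) :
    mulTensor (k := k) M N A ((m ⊗ₜ a) ⊗ₜ (n ⊗ₜ b)) = (m ⊗ₜ n) ⊗ₜ (a * b) := by
  simp [mulTensor]

/-- The coaction `m ⊗ n ↦ m₀ ⊗ n₀ ⊗ m₁ n₁`. -/
def tensorCoact (M N : Comod k H) :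
    M.carrier ⊗[k] N.carrier →ₗ[k] (M.carrier ⊗[k] N.carrier) ⊗[k] H :=
  mulTensor M.carrier N.carrier H ∘ₗ TensorProduct.map M.coact N.coact

/-- The tensor product of two comodules, with the diagonal coaction. -/
def tensor (M N : Comod k H) : Comod k H where
  carrier := M.carrier ⊗[k] N.carrier
  coact := tensorCoact M N
  coassoc x := by
    have e1 : ∀ (a : M.carrier ⊗[k] H) (b : N.carrier ⊗[k] H),
        TensorProduct.assoc k _ H H ((tensorCoact M N).rTensor H (mulTensor _ _ H (a ⊗ₜ b))) =
        mulTensor _ _ (H ⊗[k] H) (TensorProduct.assoc k _ H H (M.coact.rTensor H a) ⊗ₜ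
          TensorProduct.assoc k _ H H (N.coact.rTensor H b)) := by
      intro a b
      induction a with
      | zero => simp
      | add a a' ha ha' => simp only [map_add, add_tmul, ha, ha']
      | tmul m x =>
        induction b with
        | zero => simp
        | add a a' ha ha' => simp only [map_add, tmul_add, ha, ha']
        | tmul n y =>
          simp only [mulTensor_tmul, LinearMap.rTensor_tmul, tensorCoact, LinearMap.comp_apply,
            map_tmul]
          generalize M.coact m = p
          generalize N.coact n = q
          induction p with
          | zero => simp
          | add a a' ha ha' => simp only [map_add, add_tmul, ha, ha']
          | tmul m x =>
            induction q with
            | zero => simp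
            | add a a' ha ha' => simp only [map_add, tmul_add, add_tmul, ha, ha']
            | tmul n y => simp
    have e2 : ∀ (a : M.carrier ⊗[k] H) (b : N.carrier ⊗[k] H),
        (Coalgebra.comul (R := k)).lTensor _ (mulTensor _ _ H (a ⊗ₜ b)) =
        mulTensor _ _ (H ⊗[k] H) (Coalgebra.comul.lTensor _ a ⊗ₜ Coalgebra.comul.lTensor _ b) := by
      intro a b
      induction a with
      | zero => simp
      | add a a' ha ha' => simp only [map_add, add_tmul, ha, ha']
      | tmul m x =>
        induction b with
        | zero => simp
        | add a a' ha ha' => simp only [map_add, tmul_add, ha, ha']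
        | tmul n y => simp
    induction x with
    | zero => simp
    | add a b ha hb => simp only [map_add, ha, hb]
    | tmul m n =>
      have : tensorCoact M N (m ⊗ₜ n) = mulTensor _ _ H (M.coact m ⊗ₜ N.coact n) := rfl
      rw [this, e1, e2, M.coassoc, N.coassoc]
  counit x := by
    have e : ∀ (a : M.carrier ⊗[k] H) (b : N.carrier ⊗[k] H),
        TensorProduct.rid k _ ((Coalgebra.counit (R := k)).lTensor _ (mulTensor _ _ H (a ⊗ₜ b))) =
        TensorProduct.rid k _ (Coalgebra.counit.lTensor _ a) ⊗ₜ
          TensorProduct.rid k _ (Coalgebra.counit.lTensor _ b) := by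
      intro a b
      induction a with
      | zero => simp
      | add a a' ha ha' => simp only [map_add, add_tmul, ha, ha']
      | tmul m x =>
        induction b with
        | zero => simp
        | add a a' ha ha' => simp only [map_add, tmul_add, ha, ha']
        | tmul n y => simp [smul_tmul, tmul_smul, smul_smul, mul_comm]
    induction x with
    | zero => simp
    | add a b ha hb => simp only [map_add, ha, hb]
    | tmul m n =>
      have : tensorCoact M N (m ⊗ₜ n) = mulTensor _ _ H (M.coact m ⊗ₜ N.coact n) := rfl
      rw [this, e, M.counit, N.counit]

theorem tensorCoact_natural {M M' : Comod k H} (N : Comod k H) (f : M ⟶ M')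
    (x : M.carrier ⊗[k] N.carrier) :
    (f.lin.rTensor N.carrier).rTensor H (tensorCoact M N x) =
      tensorCoact M' N (f.lin.rTensor N.carrier x) := by
  induction x with
  | zero => simp
  | add a b ha hb => simp only [map_add, ha, hb]
  | tmul m n =>
    simp only [LinearMap.rTensor_tmul, tensorCoact, LinearMap.comp_apply, map_tmul]
    rw [← f.colinear]
    generalize M.coact m = p
    generalize N.coact n = q
    induction p with
    | zero => simp
    | add a a' ha ha' => simp only [map_add, add_tmul, ha, ha']
    | tmul m x =>
      induction q with
      | zero => simp
      | add a a' ha ha' => simp only [map_add, tmul_add, ha, ha']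
      | tmul n y => simp

/-- The functor `M ↦ M ⊗ N`. -/
def tensorRight (N : Comod k H) : Comod k H ⥤ Comod k H where
  obj M := tensor M N
  map f := ⟨f.lin.rTensor N.carrier, tensorCoact_natural N f⟩
  map_id M := Hom.ext (LinearMap.rTensor_id N.carrier M.carrier)
  map_comp f g := Hom.ext (LinearMap.rTensor_comp N.carrier g.lin f.lin)

end Comod

open Comod

/-! ## Integrals -/

/-- `Λ : H → k` is a left integral: `h₁ Λ(h₂) = Λ(h) 1` for all `h`. -/
def IsLeftIntegral (Λ : H →ₗ[k] k) : Prop :=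
  ∀ h : H, TensorProduct.rid k H (Λ.lTensor H (Coalgebra.comul h)) = Λ h • (1 : H)

section

open WithConv LinearMap

theorem comul_antipode (h : H) :
    Coalgebra.comul (R := k) (HopfAlgebra.antipode k h) =
      TensorProduct.map (HopfAlgebra.antipode k) (HopfAlgebra.antipode k)
        (TensorProduct.comm k H H (Coalgebra.comul h)) := by
  let S : H →ₗ[k] H := HopfAlgebra.antipode k
  let i : H →ₐ[k] H ⊗[k] H := Algebra.TensorProduct.includeLeft
  let j : H →ₐ[k] H ⊗[k] H := Algebra.TensorProduct.includeRight
  have hΔ : toConv (Coalgebra.comul (R := k) (A := H)) =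
      toConv i.toLinearMap * toConv j.toLinearMap := by
    ext c
    rw [LinearMap.convMul_apply]
    simp only
    generalize Coalgebra.comul (R := k) c = y
    induction y with
    | zero => simp
    | add a b ha hb => rw [map_add, map_add, ← ha, ← hb]
    | tmul a b => simp [i, j]
  have hG : toConv (TensorProduct.map S S ∘ₗ (TensorProduct.comm k H H).toLinearMap ∘ₗ
      Coalgebra.comul (R := k) (A := H)) =
      toConv (j.toLinearMap ∘ₗ S) * toConv (i.toLinearMap ∘ₗ S) := by
    ext c
    rw [LinearMap.convMul_apply]
    simp only [LinearMap.comp_apply]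
    generalize Coalgebra.comul (R := k) c = y
    induction y with
    | zero => simp
    | add a b ha hb => rw [map_add, map_add, map_add, map_add, ← ha, ← hb]
    | tmul a b => simp [i, j]
  have hS : ∀ g : H →ₐ[k] H ⊗[k] H, toConv (g.toLinearMap ∘ₗ S) * toConv g.toLinearMap = 1 := by
    intro g
    have := LinearMap.algHom_comp_convMul_distrib (R := k) g (toConv S) (toConv LinearMap.id)
    rw [LinearMap.antipode_mul_id] at this
    refine WithConv.ext (this.symm.trans ?_)
    ext c
    simp
  have h1 : toConv (TensorProduct.map S S ∘ₗ (TensorProduct.comm k H H).toLinearMap ∘ₗ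
      Coalgebra.comul (R := k) (A := H)) * toConv (Coalgebra.comul (R := k) (A := H)) = 1 := by
    rw [hG, hΔ, mul_assoc, ← mul_assoc (toConv (i.toLinearMap ∘ₗ S)), hS, one_mul, hS]
  have h2 := left_inv_eq_right_inv h1 (LinearMap.comul_right_inv (R := k) (C := H))
  exact (congrArg (fun f => f.ofConv h) h2).symm

/-- If `Λ` is a left integral then `Λ' = Λ ∘ S` is a right integral: `Λ'(h₁) h₂ = Λ'(h) 1`. -/
theorem IsLeftIntegral.comp_antipode {Λ : H →ₗ[k] k} (hΛ : IsLeftIntegral Λ) (h : H) :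
    TensorProduct.lid k H ((Λ ∘ₗ HopfAlgebra.antipode k).rTensor H (Coalgebra.comul h)) =
      Λ (HopfAlgebra.antipode k h) • (1 : H) := by
  let S : H →ₗ[k] H := HopfAlgebra.antipode k
  let f : WithConv (H →ₗ[k] H) := toConv (Algebra.linearMap k H ∘ₗ Λ ∘ₗ S)
  have h1 : f = f * toConv S := by
    ext c
    have := hΛ (S c)
    rw [LinearMap.convMul_apply]
    simp only [S] at this
    rw [comul_antipode] at this
    simp only [f, LinearMap.comp_apply, Algebra.linearMap_apply,
      Algebra.algebraMap_eq_smul_one, S]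
    rw [← this]
    generalize Coalgebra.comul (R := k) c = y
    induction y with
    | zero => simp
    | add a b ha hb => simp only [map_add, ha, hb]
    | tmul a b => simp [Algebra.algebraMap_eq_smul_one]
  have h2 : f * toConv LinearMap.id = f := by
    conv_lhs => rw [h1, mul_assoc, LinearMap.antipode_mul_id, mul_one]
  have h3 := congrArg (fun g => g.ofConv h) h2
  simp only [LinearMap.convMul_apply] at h3
  simp only [f, LinearMap.comp_apply, Algebra.linearMap_apply,
      Algebra.algebraMap_eq_smul_one, S] at h3
  rw [← h3]
  generalize Coalgebra.comul (R := k) h = y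
  induction y with
  | zero => simp
  | add a b ha hb => simp only [map_add, ha, hb]
  | tmul a b => simp [Algebra.algebraMap_eq_smul_one]

end

/-- Left multiplication by `Λ` on a comodule: `Λ · m = Λ(m₁) m₀`. -/
def integralAct (Λ : H →ₗ[k] k) (M : Comod k H) : M.carrier →ₗ[k] M.carrier :=
  (TensorProduct.rid k M.carrier).toLinearMap ∘ₗ Λ.lTensor M.carrier ∘ₗ M.coact

/-- The coinvariants `M^{co H} = {m | ρ(m) = m ⊗ 1}`. -/
def coinvariants (M : Comod k H) : Submodule k M.carrier :=
  LinearMap.eqLocus M.coact ((TensorProduct.mk k M.carrier H).flip 1)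

theorem map_mem_coinvariants {M N : Comod k H} (f : M ⟶ N) {m : M.carrier}
    (hm : m ∈ coinvariants M) : f.lin m ∈ coinvariants N := by
  have hm' : M.coact m = m ⊗ₜ 1 := hm
  change N.coact (f.lin m) = f.lin m ⊗ₜ 1
  rw [← f.colinear, hm', LinearMap.rTensor_tmul]

theorem map_integralAct (Λ : H →ₗ[k] k) {M N : Comod k H} (f : M ⟶ N) (m : M.carrier) :
    f.lin (integralAct Λ M m) = integralAct Λ N (f.lin m) := by
  simp only [integralAct, LinearMap.comp_apply]
  rw [← f.colinear]
  generalize M.coact m = x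
  induction x with
  | zero => simp
  | add a b ha hb => simp only [map_add, ha, hb]
  | tmul a b => simp

/-- For a left integral, `Λ · M ⊆ M^{co H}`. -/
theorem IsLeftIntegral.integralAct_mem {Λ : H →ₗ[k] k} (hΛ : IsLeftIntegral Λ) (M : Comod k H)
    (m : M.carrier) : integralAct Λ M m ∈ coinvariants M := by
  change M.coact (integralAct Λ M m) = integralAct Λ M m ⊗ₜ 1
  simp only [integralAct, LinearMap.comp_apply]
  have e1 : ∀ x : M.carrier ⊗[k] H, M.coact ((TensorProduct.rid k M.carrier).toLinearMap
      (Λ.lTensor M.carrier x)) = (TensorProduct.rid k H).toLinearMap.lTensor M.carrier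
        ((Λ.lTensor H).lTensor M.carrier
          (TensorProduct.assoc k M.carrier H H (M.coact.rTensor H x))) := by
    intro x
    induction x with
    | zero => simp
    | add a b ha hb => simp only [map_add, ha, hb]
    | tmul a b =>
      simp only [LinearMap.lTensor_tmul, LinearMap.rTensor_tmul, LinearEquiv.coe_coe, rid_tmul,
        map_smul]
      generalize M.coact a = y
      induction y with
      | zero => simp
      | add a b ha hb => simp only [map_add, add_tmul, smul_add, ha, hb]
      | tmul c d => simp
  rw [e1, M.coassoc]
  generalize M.coact m = x
  induction x with
  | zero => simp
  | add a b ha hb => simp only [map_add, add_tmul, ha, hb]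
  | tmul a b =>
    have := hΛ b
    simp only [LinearMap.lTensor_tmul, LinearEquiv.coe_coe, this]
    simp [smul_tmul]

/-! ## Hopf homology -/

/-- `H_0(M) = M^{co H} / Λ · M`. -/
def homologyZero (Λ : H →ₗ[k] k) : Comod k H ⥤ ModuleCat.{v} k where
  obj M := ModuleCat.of k
    (coinvariants M ⧸ (LinearMap.range (integralAct Λ M)).submoduleOf (coinvariants M))
  map {M N} f := ModuleCat.ofHom (Submodule.mapQ _ _
    (f.lin.restrict (p := coinvariants M) (q := coinvariants N)
      fun _ hm => map_mem_coinvariants f hm) (by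
        rintro ⟨_, _⟩ ⟨m, rfl⟩
        exact ⟨f.lin m, (map_integralAct Λ f m).symm⟩))
  map_id M := by
    refine ModuleCat.hom_ext (LinearMap.ext fun x => ?_)
    obtain ⟨x, rfl⟩ := Submodule.mkQ_surjective _ x
    rfl
  map_comp f g := by
    refine ModuleCat.hom_ext (LinearMap.ext fun x => ?_)
    obtain ⟨x, rfl⟩ := Submodule.mkQ_surjective _ x
    rfl

/-- The suspension `T(M) = (M ⊗ H) / ρ(M)`, where `M ⊗ H` is cofree. -/
abbrev suspObj (M : Comod k H) : Comod k H := coker M.coactHom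

/-- The map `T(f) : T(M) → T(N)` induced by `f ⊗ id`. -/
def suspMap {M N : Comod k H} (f : M ⟶ N) : suspObj M ⟶ suspObj N :=
  cokerDesc _ (cofreeMap f ≫ cokerπ N.coactHom) (by
    rw [← Category.assoc, coactHom_naturality, Category.assoc, coker_condition, Limits.comp_zero])

@[simp] theorem cokerπ_suspMap {M N : Comod k H} (f : M ⟶ N) :
    cokerπ M.coactHom ≫ suspMap f = cofreeMap f ≫ cokerπ N.coactHom := rfl

theorem suspMap_id (M : Comod k H) : suspMap (𝟙 M) = 𝟙 (suspObj M) :=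
  coker_hom_ext (by
    have : cofreeMap (𝟙 M) = 𝟙 _ := Hom.ext (LinearMap.rTensor_id H M.carrier)
    rw [cokerπ_suspMap, this, Category.id_comp, Category.comp_id])

theorem suspMap_comp {M N P : Comod k H} (f : M ⟶ N) (g : N ⟶ P) :
    suspMap (f ≫ g) = suspMap f ≫ suspMap g :=
  coker_hom_ext (by
    have : cofreeMap (f ≫ g) = cofreeMap f ≫ cofreeMap g :=
      Hom.ext (LinearMap.rTensor_comp H g.lin f.lin)
    rw [cokerπ_suspMap, ← Category.assoc, cokerπ_suspMap, Category.assoc, cokerπ_suspMap, this,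
      Category.assoc])

theorem suspMap_sub {M N : Comod k H} (f g : M ⟶ N) :
    suspMap (f - g) = suspMap f - suspMap g := by
  have h : cofreeMap (f - g) = cofreeMap f - cofreeMap g := by
    have e : (f - g).lin = f.lin - g.lin := LinearMap.ext fun x => sub_lin f g x
    refine Hom.ext (LinearMap.ext fun x => ?_)
    refine Eq.trans ?_ (sub_lin (cofreeMap f) (cofreeMap g) x).symm
    change (f - g).lin.rTensor H x = f.lin.rTensor H x - g.lin.rTensor H x
    rw [e, LinearMap.rTensor_sub]
    rfl
  refine coker_hom_ext ?_
  rw [Preadditive.comp_sub, cokerπ_suspMap, cokerπ_suspMap, cokerπ_suspMap, h,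
    Preadditive.sub_comp]

variable (k H) in
/-- The suspension functor `T`. -/
def suspension : Comod k H ⥤ Comod k H where
  obj M := suspObj M
  map f := suspMap f
  map_id M := suspMap_id M
  map_comp f g := suspMap_comp f g

variable (k H) in
/-- `H` as a right comodule over itself. -/
def regular : Comod k H where
  carrier := H
  coact := Coalgebra.comul
  coassoc := Coalgebra.coassoc_apply
  counit h := by rw [Coalgebra.lTensor_counit_comul]; simp

theorem IsLeftIntegral.ker_stable {Λ : H →ₗ[k] k} (hΛ : IsLeftIntegral Λ) :
    ∀ h ∈ LinearMap.ker (Λ ∘ₗ HopfAlgebra.antipode k), Coalgebra.comul (R := k) h ∈ LinearMap.range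
      ((LinearMap.ker (Λ ∘ₗ HopfAlgebra.antipode (A := H) k)).subtype.rTensor H) := by
    intro h hh
    have hex : Function.Exact
        ((LinearMap.ker (Λ ∘ₗ HopfAlgebra.antipode k)).subtype.rTensor H)
        ((Λ ∘ₗ HopfAlgebra.antipode k).rTensor H) :=
      Module.Flat.rTensor_exact H (LinearMap.exact_subtype_ker_map _)
    apply (hex _).1
    apply (TensorProduct.lid k H).injective
    have h1 : Λ (HopfAlgebra.antipode k h) = 0 := hh
    have h2 := hΛ.comp_antipode h
    rw [h1, zero_smul] at h2
    rw [map_zero]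
    exact h2

/-- The subcomodule `Ker(Λ ∘ S)` of `H`, for a left integral `Λ`. -/
def kerIntegral {Λ : H →ₗ[k] k} (hΛ : IsLeftIntegral Λ) : Comod k H :=
  (regular k H).sub (LinearMap.ker (Λ ∘ₗ HopfAlgebra.antipode (A := H) k)) hΛ.ker_stable

/-- The desuspension `T'(M) = M ⊗ Ker(Λ ∘ S)`, with the diagonal coaction. -/
def desuspension {Λ : H →ₗ[k] k} (hΛ : IsLeftIntegral Λ) : Comod k H ⥤ Comod k H :=
  tensorRight (kerIntegral hΛ)

/-- The `n`-fold iterate of an endofunctor. -/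
def iterate {C : Type*} [Category* C] (F : C ⥤ C) : ℕ → (C ⥤ C)
  | 0 => 𝟭 C
  | n + 1 => F ⋙ iterate F n

/-- `H_n(M) = H_0(T'^n M)` and `H_{-n}(M) = H_0(T^n M)` for `n ≥ 0`. -/
def homology {Λ : H →ₗ[k] k} (hΛ : IsLeftIntegral Λ) : ℤ → (Comod k H ⥤ ModuleCat.{v} k)
  | Int.ofNat n => iterate (desuspension hΛ) n ⋙ homologyZero Λ
  | Int.negSucc n => iterate (suspension k H) (n + 1) ⋙ homologyZero Λ

/-! ## The stable category -/

/-- `f` factors through an injective comodule. -/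
def FactorsThroughInjective {M N : Comod k H} (f : M ⟶ N) : Prop :=
  ∃ (I : Comod k H) (_ : Injective I) (a : M ⟶ I) (b : I ⟶ N), a ≫ b = f

theorem factorsThroughInjective_iff {M N : Comod k H} (f : M ⟶ N) :
    FactorsThroughInjective f ↔ ∃ g : cofree k H M.carrier ⟶ N, M.coactHom ≫ g = f := by
  constructor
  · rintro ⟨I, _, a, b, rfl⟩
    exact ⟨Injective.factorThru a M.coactHom ≫ b, by
      rw [← Category.assoc, Injective.comp_factorThru]⟩
  · rintro ⟨g, rfl⟩
    exact ⟨_, cofree_injective _, _, _, rfl⟩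

variable (k H) in
/-- Two colinear maps are stably equal if their difference factors through an injective. -/
def stableRel : HomRel (Comod k H) := fun _ _ f g => FactorsThroughInjective (f - g)

instance : Congruence (stableRel k H) where
  comp_left f g g' := by
    rintro ⟨I, hI, a, b, h⟩
    exact ⟨I, hI, f ≫ a, b, by rw [Category.assoc, h, Preadditive.comp_sub]⟩
  comp_right g := by
    rintro ⟨I, hI, a, b, h⟩
    exact ⟨I, hI, a, b ≫ g, by rw [← Category.assoc, h, Preadditive.sub_comp]⟩
  equivalence :=
    { refl := fun f => (factorsThroughInjective_iff _).2 ⟨0, by simp⟩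
      symm := by
        rintro f g ⟨I, hI, a, b, h⟩
        exact ⟨I, hI, a, -b, by rw [Preadditive.comp_neg, h, neg_sub]⟩
      trans := by
        intro f g h h1 h2
        obtain ⟨a, ha⟩ := (factorsThroughInjective_iff _).1 h1
        obtain ⟨b, hb⟩ := (factorsThroughInjective_iff _).1 h2
        exact (factorsThroughInjective_iff _).2
          ⟨a + b, by rw [Preadditive.comp_add, ha, hb, sub_add_sub_cancel]⟩ }

theorem stableRel_add ⦃M N : Comod k H⦄ (f₁ f₂ g₁ g₂ : M ⟶ N) (hf : stableRel k H f₁ f₂)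
    (hg : stableRel k H g₁ g₂) : stableRel k H (f₁ + g₁) (f₂ + g₂) := by
  obtain ⟨a, ha⟩ := (factorsThroughInjective_iff _).1 hf
  obtain ⟨b, hb⟩ := (factorsThroughInjective_iff _).1 hg
  exact (factorsThroughInjective_iff _).2
    ⟨a + b, by rw [Preadditive.comp_add, ha, hb, add_sub_add_comm]⟩

variable (k H) in
/-- The stable category: comodules, with colinear maps modulo those that factor through an
injective comodule. -/
abbrev Stable := CategoryTheory.Quotient (stableRel k H)

instance : Preadditive (Stable k H) := CategoryTheory.Quotient.preadditive _ stableRel_add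

variable (k H) in
/-- The projection from comodules to the stable category. -/
abbrev toStable : Comod k H ⥤ Stable k H := CategoryTheory.Quotient.functor (stableRel k H)

theorem suspObj_injective (I : Comod k H) [Injective I] : Injective (suspObj I) := by
  let r : cofree k H I.carrier ⟶ I := Injective.factorThru (𝟙 I) I.coactHom
  have hr : I.coactHom ≫ r = 𝟙 I := Injective.comp_factorThru _ _
  have h0 : I.coactHom ≫ (𝟙 _ - r ≫ I.coactHom) = 0 := by
    rw [Preadditive.comp_sub, ← Category.assoc, hr]; simp
  have ret : Retract (suspObj I) (cofree k H I.carrier) :=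
    { i := cokerDesc _ _ h0
      r := cokerπ _
      retract := coker_hom_ext (by
        rw [← Category.assoc, cokerπ_desc, Preadditive.sub_comp, Category.assoc, coker_condition]
        simp) }
  exact ret.injective

variable (k H) in
/-- The suspension functor `T` on the stable category. -/
def stableSuspension : Stable k H ⥤ Stable k H :=
  CategoryTheory.Quotient.lift _ (suspension k H ⋙ toStable k H) (by
    rintro M N f g ⟨I, hI, a, b, h⟩
    refine CategoryTheory.Quotient.sound _ ⟨_, suspObj_injective I, suspMap a, suspMap b, ?_⟩
    change suspMap a ≫ suspMap b = suspMap f - suspMap g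
    rw [← suspMap_comp, h, suspMap_sub])

/-! ## Triangles -/

/-- The map `(ρ, -f) : X → (X ⊗ H) ⊕ Y`. -/
def coneRel {X Y : Comod k H} (f : X ⟶ Y) : X ⟶ prod (cofree k H X.carrier) Y :=
  X.coactHom ≫ inl _ _ - f ≫ inr _ _

/-- The mapping cone `Co(f)`: the pushout of `X ⊗ H` and `Y` under `X`. -/
abbrev cone {X Y : Comod k H} (f : X ⟶ Y) : Comod k H := coker (coneRel f)

/-- The map `Y → Co(f)`. -/
def coneInr {X Y : Comod k H} (f : X ⟶ Y) : Y ⟶ cone f := inr _ _ ≫ cokerπ (coneRel f)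

/-- The map `X ⊗ H → Co(f)`. -/
def coneInl {X Y : Comod k H} (f : X ⟶ Y) : cofree k H X.carrier ⟶ cone f :=
  inl _ _ ≫ cokerπ (coneRel f)

theorem coneRel_comp {X Y P : Comod k H} (f : X ⟶ Y) (a : cofree k H X.carrier ⟶ P) (b : Y ⟶ P)
    (h : X.coactHom ≫ a = f ≫ b) : coneRel f ≫ coprod a b = 0 := by
  rw [coneRel, Preadditive.sub_comp, Category.assoc, Category.assoc, inl_coprod, inr_coprod, h,
    sub_self]

theorem cone_isPushout {X Y : Comod k H} (f : X ⟶ Y) :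
    IsPushout X.coactHom f (coneInl f) (coneInr f) := by
  refine ⟨⟨?_⟩, ⟨Limits.PushoutCocone.IsColimit.mk _
    (fun s => cokerDesc _ (coprod s.inl s.inr) (coneRel_comp f _ _ s.condition)) ?_ ?_ ?_⟩⟩
  · have h : ∀ g : prod (cofree k H X.carrier) Y ⟶ cone f, coneRel f ≫ g = 0 →
        X.coactHom ≫ inl _ _ ≫ g = f ≫ inr _ _ ≫ g := by
      intro g hg
      rw [coneRel, Preadditive.sub_comp, sub_eq_zero] at hg
      simpa using hg
    exact h _ (coker_condition _)
  · intro s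
    rw [coneInl, Category.assoc, cokerπ_desc, inl_coprod]
  · intro s
    rw [coneInr, Category.assoc, cokerπ_desc, inr_coprod]
  · intro s m h1 h2
    refine coker_hom_ext (prod_hom_ext ?_ ?_)
    · rw [cokerπ_desc, inl_coprod, ← h1, coneInl, Category.assoc]
    · rw [cokerπ_desc, inr_coprod, ← h2, coneInr, Category.assoc]

/-- The map `Co(f) → T(X)` that is the projection on `X ⊗ H` and zero on `Y`. -/
def coneδ {X Y : Comod k H} (f : X ⟶ Y) : cone f ⟶ suspObj X :=
  cokerDesc _ (coprod (cokerπ X.coactHom) 0) (coneRel_comp f _ _ (by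
    rw [coker_condition, Limits.comp_zero]))

/-- The class of `Co(f) → T(X)` in the stable category. -/
def stableConeδ {X Y : Comod k H} (f : X ⟶ Y) :
    (toStable k H).obj (cone f) ⟶ (stableSuspension k H).obj ((toStable k H).obj X) :=
  (toStable k H).map (coneδ f)

/-- A sequence `X → Y → Z → T X` in the stable category is a (distinguished) triangle if it is
isomorphic to `A → B → Co(f) → T A` for some colinear map `f : A → B`. -/
def IsTriangle {X Y Z : Stable k H} (u : X ⟶ Y) (v : Y ⟶ Z)
    (w : Z ⟶ (stableSuspension k H).obj X) : Prop :=
  ∃ (A B : Comod k H) (f : A ⟶ B) (a : X ≅ (toStable k H).obj A) (b : Y ≅ (toStable k H).obj B)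
    (c : Z ≅ (toStable k H).obj (cone f)),
    u ≫ b.hom = a.hom ≫ (toStable k H).map f ∧
    v ≫ c.hom = b.hom ≫ (toStable k H).map (coneInr f) ∧
    w ≫ (stableSuspension k H).map a.hom = c.hom ≫ stableConeδ f

/-- A functor on comodules descends to the stable category if it does not distinguish stably
equal maps. -/
def Descends (F : Comod k H ⥤ ModuleCat.{v} k) : Prop :=
  ∀ (M N : Comod k H) (f g : M ⟶ N), stableRel k H f g → F.map f = F.map g

/-- The functors `H_n` on the stable category, given that they descend. -/
def stableHomology {Λ : H →ₗ[k] k} (hΛ : IsLeftIntegral Λ)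
    (hdesc : ∀ n : ℤ, Descends (homology hΛ n)) (n : ℤ) : Stable k H ⥤ ModuleCat.{v} k :=
  CategoryTheory.Quotient.lift _ (homology hΛ n) (hdesc n)

end CoFrobenius

end

noncomputable section

namespace CoFrobenius

variable {k : Type u} {H : Type v} [Field k] [Ring H] [HopfAlgebra k H]

open Comod

/-! ## The bilinear form of an integral -/

/-! The engine is a trace, as in Higman's criterion for relative projectivity. The integral turns a
linear map `g : M → N` into the colinear map `m ↦ g(m₀)₀ Λ(g(m₀)₁ S(m₁))`; colinearity comes from
`slide`. Traces absorb colinear maps on both sides and factor through the injective `N ⊗ H`. The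
identity of a cofree comodule is a trace, because some `x` has `Λ(x) = 1`. Hence the maps that
factor through an injective are exactly the traces (`factorsThroughInjective_iff_trace`).

Three things follow. On a coinvariant `m` the trace is `Λ · g(m)`, so `H_0` kills it. The functor
`T'` sends the trace of `g` to the trace of `g ⊗ id` (`trace_rTensor`), so its iterates preserve
maps through injectives; for `T` this holds because `T` preserves injectives. Finally, linear
sections can be averaged, so injectives are projective (`exists_lift`).

For the degree shift, `Λ ∘ S` is a right integral, and it is nonzero (`comp_antipode_ne_zero`). So
`0 → T'(N) → N ⊗ H → N → 0` is exact, with injective middle term because the diagonal `N ⊗ H` is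
cofree after a shear. Take `N = T(M)` and compare with `0 → M → M ⊗ H → T(M) → 0`: Schanuel's
argument gives a map `M → T'(T(M))` that is stably invertible, and it is natural when the lift is
the trace of a natural linear map (`exists_unit`). Applying `H_n` gives `θ_n` for `n ≥ 0`; for `n <
0` the two functors agree by definition.

For exactness, `T` and `T'` are exact and `H_0` is exact in the middle, so each `H_n` is exact in
the middle on short exact sequences. A cone sits in three of these: `A → (A ⊗ H) ⊕ B → Co(f)`, `B →
Co(f) → T(A)` and `Co(f) → T(A) ⊕ (B ⊗ H) → T(B)`. They make `H_m` exact along `A → B → Co(f) → T(A)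
→ T(B)`, and `θ` rewrites the last two terms in the next lower degree. -/

/-- The bilinear form `(y, h) ↦ Λ(y S(h))`. -/
def pairing (Λ : H →ₗ[k] k) : H →ₗ[k] H →ₗ[k] k :=
  ((LinearMap.mul k H).compr₂ Λ).compl₂ (HopfAlgebra.antipode k)

@[simp] theorem pairing_apply (Λ : H →ₗ[k] k) (y h : H) :
    pairing Λ y h = Λ (y * HopfAlgebra.antipode k h) := rfl

/-- `y ⊗ h ↦ y₁ Λ(y₂ S(h))`. -/
def slideLeft (Λ : H →ₗ[k] k) : H ⊗[k] H →ₗ[k] H :=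
  (TensorProduct.rid k H).toLinearMap ∘ₗ (TensorProduct.lift (pairing Λ)).lTensor H ∘ₗ
    (TensorProduct.assoc k H H H).toLinearMap ∘ₗ Coalgebra.comul.rTensor H

theorem slideLeft_tmul (Λ : H →ₗ[k] k) (y h : H) : slideLeft Λ (y ⊗ₜ h) =
    TensorProduct.rid k H (((pairing Λ).flip h).lTensor H (Coalgebra.comul y)) := by
  simp only [slideLeft, LinearMap.comp_apply, LinearMap.rTensor_tmul, LinearEquiv.coe_coe]
  generalize (Coalgebra.comul (R := k) y) = z
  induction z with
  | zero => simp
  | add a b ha hb => simp only [map_add, add_tmul, ha, hb]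
  | tmul a b => simp

open WithConv LinearMap in
/-- `y₁ Λ(y₂ S(h)) = Λ(y S(h₁)) h₂`. -/
theorem IsLeftIntegral.slide {Λ : H →ₗ[k] k} (hΛ : IsLeftIntegral Λ) (y h : H) :
    TensorProduct.rid k H (((pairing Λ).flip h).lTensor H (Coalgebra.comul y)) =
      TensorProduct.lid k H ((pairing Λ y).rTensor H (Coalgebra.comul h)) := by
  let F : H →ₗ[k] H := slideLeft Λ ∘ₗ TensorProduct.mk k H H y
  let G : H →ₗ[k] H := Algebra.linearMap k H ∘ₗ pairing Λ y
  -- The integral identity at `y S(c)`, where `Δ(y S(c)) = y₁ S(c₂) ⊗ y₂ S(c₁)`, is a convolution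
  -- equation `F * S = G`. Convolving with the identity on the right then removes `S`.
  have h1 : toConv F * toConv (HopfAlgebra.antipode k) = toConv G := by
    ext c
    have e := hΛ (y * HopfAlgebra.antipode k c)
    rw [Bialgebra.comul_mul, comul_antipode] at e
    rw [LinearMap.convMul_apply]
    simp only [G, LinearMap.comp_apply, Algebra.linearMap_apply, Algebra.algebraMap_eq_smul_one,
      pairing_apply]
    rw [← e]
    generalize Coalgebra.comul (R := k) c = z
    induction z with
    | zero => simp
    | add a b ha hb => simp only [map_add, mul_add, ha, hb]
    | tmul a b =>
      simp only [TensorProduct.map_tmul, F, LinearMap.comp_apply, TensorProduct.mk_apply,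
        slideLeft_tmul, LinearMap.mul'_apply, TensorProduct.comm_tmul]
      generalize Coalgebra.comul (R := k) y = w
      induction w with
      | zero => simp
      | add a b ha hb => simp only [map_add, add_mul, ha, hb]
      | tmul c d => simp
  have h2 : toConv F = toConv G * toConv LinearMap.id := by
    rw [← h1, mul_assoc, LinearMap.antipode_mul_id, mul_one]
  have h3 := congrArg (fun g => g.ofConv h) h2
  simp only [LinearMap.convMul_apply] at h3
  refine (slideLeft_tmul Λ y h).symm.trans (h3.trans ?_)
  generalize Coalgebra.comul (R := k) h = z
  induction z with
  | zero => simp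
  | add a b ha hb => simp only [map_add, ha, hb]
  | tmul a b => simp [G, Algebra.algebraMap_eq_smul_one]

/-! ## Averaging linear maps -/

theorem coact_integralAct (φ : H →ₗ[k] k) (M : Comod k H) (m : M.carrier) :
    M.coact (integralAct φ M m) = ((TensorProduct.rid k H).toLinearMap ∘ₗ φ.lTensor H ∘ₗ
      Coalgebra.comul).lTensor M.carrier (M.coact m) := by
  simp only [integralAct, LinearMap.comp_apply]
  have e1 : ∀ x : M.carrier ⊗[k] H, M.coact ((TensorProduct.rid k M.carrier).toLinearMap
      (φ.lTensor M.carrier x)) = (TensorProduct.rid k H).toLinearMap.lTensor M.carrier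
        ((φ.lTensor H).lTensor M.carrier
          (TensorProduct.assoc k M.carrier H H (M.coact.rTensor H x))) := by
    intro x
    induction x with
    | zero => simp
    | add a b ha hb => simp only [map_add, ha, hb]
    | tmul a b =>
      simp only [LinearMap.lTensor_tmul, LinearMap.rTensor_tmul, LinearEquiv.coe_coe, rid_tmul,
        map_smul]
      generalize M.coact a = y
      induction y with
      | zero => simp
      | add a b ha hb => simp only [map_add, add_tmul, smul_add, ha, hb]
      | tmul c d => simp
  rw [e1, M.coassoc]
  simp only [LinearMap.lTensor_comp_apply]

/-- The map `n ⊗ h ↦ n₀ Λ(n₁ S(h))` for a coaction `ρ(n) = n₀ ⊗ n₁`. -/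
def average (Λ : H →ₗ[k] k) {V : Type v} [AddCommGroup V] [Module k V] (ρ : V →ₗ[k] V ⊗[k] H) :
    V ⊗[k] H →ₗ[k] V :=
  (TensorProduct.rid k V).toLinearMap ∘ₗ (TensorProduct.lift (pairing Λ)).lTensor V ∘ₗ
    (TensorProduct.assoc k V H H).toLinearMap ∘ₗ ρ.rTensor H

theorem average_tmul (Λ : H →ₗ[k] k) {V : Type v} [AddCommGroup V] [Module k V]
    (ρ : V →ₗ[k] V ⊗[k] H) (n : V) (h : H) :
    average Λ ρ (n ⊗ₜ h) = TensorProduct.rid k V (((pairing Λ).flip h).lTensor V (ρ n)) := by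
  simp only [average, LinearMap.comp_apply, LinearMap.rTensor_tmul, LinearEquiv.coe_coe]
  generalize ρ n = z
  induction z with
  | zero => simp
  | add a b ha hb => simp only [map_add, add_tmul, ha, hb]
  | tmul a b => simp

theorem average_tmul_coact (Λ : H →ₗ[k] k) (N : Comod k H) (n : N.carrier) (h : H) :
    average Λ N.coact (n ⊗ₜ h) = integralAct ((pairing Λ).flip h) N n :=
  average_tmul Λ N.coact n h

/-- By coassociativity the claim is `n₀ ⊗ n₁ Λ(n₂ S(h)) = n₀ ⊗ Λ(n₁ S(h₁)) h₂`, which is `slide`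
applied to the `H`-component of `ρ(n)`. -/
theorem IsLeftIntegral.average_colinear {Λ : H →ₗ[k] k} (hΛ : IsLeftIntegral Λ) (N : Comod k H)
    (x : N.carrier ⊗[k] H) :
    (average Λ N.coact).rTensor H (cofreeCoact k H N.carrier x) = N.coact (average Λ N.coact x) := by
  induction x with
  | zero => simp
  | add a b ha hb => simp only [map_add, ha, hb]
  | tmul n h =>
    rw [average_tmul_coact, coact_integralAct]
    simp only [cofreeCoact, LinearMap.comp_apply, LinearMap.lTensor_tmul, LinearEquiv.coe_coe]
    have e1 : ∀ z : H ⊗[k] H, (average Λ N.coact).rTensor H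
        ((TensorProduct.assoc k N.carrier H H).symm (n ⊗ₜ z)) =
        (TensorProduct.rid k N.carrier).toLinearMap.rTensor H
          ((TensorProduct.assoc k N.carrier k H).symm (
            (((TensorProduct.lift (pairing Λ)).rTensor H ∘ₗ
              (TensorProduct.assoc k H H H).symm.toLinearMap).lTensor N.carrier)
            (TensorProduct.assoc k N.carrier H (H ⊗[k] H) (N.coact n ⊗ₜ z)))) := by
      intro z
      induction z with
      | zero => simp
      | add a b ha hb => simp only [map_add, tmul_add, ha, hb]
      | tmul a b =>
        simp only [assoc_symm_tmul, LinearMap.rTensor_tmul, average, LinearMap.comp_apply]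
        generalize N.coact n = w
        induction w with
        | zero => simp
        | add a b ha hb => simp only [map_add, add_tmul, ha, hb]
        | tmul c d => simp
    rw [e1]
    generalize N.coact n = w
    induction w with
    | zero => simp
    | add a b ha hb => simp only [map_add, add_tmul, ha, hb]
    | tmul p c =>
      have e2 := hΛ.slide c h
      simp only [LinearMap.lTensor_tmul, assoc_tmul, LinearMap.comp_apply, LinearEquiv.coe_coe]
      rw [e2]
      generalize Coalgebra.comul (R := k) h = z
      induction z with
      | zero => simp
      | add a b ha hb => simp only [map_add, tmul_add, ha, hb]
      | tmul a b => simp [smul_tmul]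

/-- The colinear map `N ⊗ H → N`, `n ⊗ h ↦ n₀ Λ(n₁ S(h))`. -/
def IsLeftIntegral.averageHom {Λ : H →ₗ[k] k} (hΛ : IsLeftIntegral Λ) (N : Comod k H) :
    cofree k H N.carrier ⟶ N :=
  ⟨average Λ N.coact, hΛ.average_colinear N⟩

/-- The colinear map `m ↦ g(m₀)₀ Λ(g(m₀)₁ S(m₁))` attached to a linear map `g`. -/
def IsLeftIntegral.trace {Λ : H →ₗ[k] k} (hΛ : IsLeftIntegral Λ) {M N : Comod k H}
    (g : M.carrier →ₗ[k] N.carrier) : M ⟶ N :=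
  cofreeLift M g ≫ hΛ.averageHom N

theorem average_natural (Λ : H →ₗ[k] k) {N P : Comod k H} (b : N ⟶ P) (x : N.carrier ⊗[k] H) :
    b.lin (average Λ N.coact x) = average Λ P.coact (b.lin.rTensor H x) := by
  induction x with
  | zero => simp
  | add x y hx hy => simp only [map_add, hx, hy]
  | tmul n h => rw [LinearMap.rTensor_tmul, average_tmul_coact, average_tmul_coact, map_integralAct]

namespace IsLeftIntegral

variable {Λ : H →ₗ[k] k} (hΛ : IsLeftIntegral Λ)

theorem trace_lin {M N : Comod k H} (g : M.carrier →ₗ[k] N.carrier) (m : M.carrier) :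
    (hΛ.trace g).lin m = average Λ N.coact (g.rTensor H (M.coact m)) := rfl

/-- This and `comp_trace` let colinear maps move inside a trace, where they may be combined with
maps that are only linear. -/
theorem trace_comp {M N P : Comod k H} (g : M.carrier →ₗ[k] N.carrier) (b : N ⟶ P) :
    hΛ.trace g ≫ b = hΛ.trace (b.lin ∘ₗ g) := by
  ext m
  rw [comp_lin, trace_lin, trace_lin, average_natural, LinearMap.rTensor_comp_apply]

theorem comp_trace {M N P : Comod k H} (a : M ⟶ N) (g : N.carrier →ₗ[k] P.carrier) :
    a ≫ hΛ.trace g = hΛ.trace (g ∘ₗ a.lin) := by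
  ext m
  rw [comp_lin, trace_lin, trace_lin, ← a.colinear, LinearMap.rTensor_comp_apply]

theorem trace_factors {M N : Comod k H} (g : M.carrier →ₗ[k] N.carrier) :
    FactorsThroughInjective (hΛ.trace g) :=
  ⟨_, cofree_injective N.carrier, cofreeLift M g, hΛ.averageHom N, rfl⟩

end IsLeftIntegral

/-! ### Maps through injectives are traces -/

theorem pairing_mul_comul (Λ : H →ₗ[k] k) (x h : H) :
    TensorProduct.lift (pairing Λ ∘ₗ LinearMap.mulLeft k x) (Coalgebra.comul h) =
      Λ x * Coalgebra.counit (R := k) h := by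
  have e : ∀ z : H ⊗[k] H, TensorProduct.lift (pairing Λ ∘ₗ LinearMap.mulLeft k x) z =
      Λ (x * LinearMap.mul' k H ((HopfAlgebra.antipode k).lTensor H z)) := by
    intro z
    induction z with
    | zero => simp
    | add a b ha hb => simp only [map_add, mul_add, ha, hb]
    | tmul a b => simp [mul_assoc]
  rw [e, HopfAlgebra.mul_antipode_lTensor_comul_apply]
  simp [Algebra.algebraMap_eq_smul_one, mul_comm]

namespace IsLeftIntegral

variable {Λ : H →ₗ[k] k} (hΛ : IsLeftIntegral Λ)

include hΛ in
/-- `x₁ h₁ Λ(x₂ h₂ S(h₃)) = Λ(x) h`. -/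
theorem average_comul (x h : H) :
    average Λ Coalgebra.comul ((LinearMap.mulLeft k x).rTensor H (Coalgebra.comul h)) =
      Λ x • h := by
  -- Using `slide` at the product `x h₁` turns the left side into `Λ(x h₁ S(h₂)) h₃`, where `h₁
  -- S(h₂)` cancels.
  have e1 : ∀ z : H ⊗[k] H, average Λ Coalgebra.comul ((LinearMap.mulLeft k x).rTensor H z) =
      TensorProduct.lid k H ((TensorProduct.lift (pairing Λ ∘ₗ LinearMap.mulLeft k x)).rTensor H
        ((TensorProduct.assoc k H H H).symm (Coalgebra.comul.lTensor H z))) := by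
    intro z
    induction z with
    | zero => simp
    | add a b ha hb => simp only [map_add, ha, hb]
    | tmul a b =>
      rw [LinearMap.rTensor_tmul, average_tmul, LinearMap.mulLeft_apply, hΛ.slide (x * a) b]
      simp only [LinearMap.lTensor_tmul]
      generalize Coalgebra.comul (R := k) b = w
      induction w with
      | zero => simp
      | add a b ha hb => simp only [map_add, tmul_add, ha, hb]
      | tmul c d => simp
  rw [e1, Coalgebra.coassoc_symm_apply]
  have e2 : ∀ z : H ⊗[k] H, TensorProduct.lid k H
      ((TensorProduct.lift (pairing Λ ∘ₗ LinearMap.mulLeft k x)).rTensor H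
        (Coalgebra.comul.rTensor H z)) =
      Λ x • TensorProduct.lid k H ((Coalgebra.counit (R := k)).rTensor H z) := by
    intro z
    induction z with
    | zero => simp
    | add a b ha hb => simp only [map_add, smul_add, ha, hb]
    | tmul a b => simp [pairing_mul_comul, mul_smul]
  rw [e2, Coalgebra.rTensor_counit_comul]
  simp

theorem _root_.CoFrobenius.average_cofreeCoact (Λ : H →ₗ[k] k) {V : Type v} [AddCommGroup V]
    [Module k V] (v : V) (a b : H) : average Λ (cofreeCoact k H V) ((v ⊗ₜ[k] a) ⊗ₜ[k] b) =
      v ⊗ₜ[k] average Λ Coalgebra.comul (a ⊗ₜ[k] b) := by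
  rw [average_tmul, average_tmul]
  simp only [cofreeCoact, LinearMap.comp_apply, LinearMap.lTensor_tmul, LinearEquiv.coe_coe]
  generalize Coalgebra.comul (R := k) a = z
  induction z with
  | zero => simp
  | add a b ha hb => simp only [map_add, tmul_add, ha, hb]
  | tmul a b => simp

include hΛ in
theorem average_cofree {V : Type v} [AddCommGroup V] [Module k V] (x : H) (m : V ⊗[k] H) :
    average Λ (cofreeCoact k H V) (((LinearMap.mulLeft k x).lTensor V).rTensor H
      (cofreeCoact k H V m)) = Λ x • m := by
  induction m with
  | zero => simp
  | add a b ha hb => simp only [map_add, smul_add, ha, hb]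
  | tmul v h =>
    rw [← tmul_smul, ← hΛ.average_comul x h]
    simp only [cofreeCoact, LinearMap.comp_apply, LinearMap.lTensor_tmul, LinearEquiv.coe_coe]
    generalize Coalgebra.comul (R := k) h = z
    induction z with
    | zero => simp
    | add a b ha hb => simp only [map_add, tmul_add, ha, hb]
    | tmul a b => exact average_cofreeCoact Λ v (x * a) b

/-- The witness is `id ⊗ (x ·)` with `Λ(x) = 1`, so `x` plays the role of an element of trace one.
-/
theorem exists_trace_eq_id_cofree (hne : Λ ≠ 0) (V : Type v) [AddCommGroup V] [Module k V] :
    ∃ g, hΛ.trace (M := cofree k H V) (N := cofree k H V) g = 𝟙 _ := by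
  obtain ⟨x, hx⟩ : ∃ x, Λ x = 1 := LinearMap.surjective hne 1
  refine ⟨(LinearMap.mulLeft k x).lTensor V, ?_⟩
  ext m
  exact (hΛ.average_cofree x m).trans (by rw [hx]; exact one_smul k (show V ⊗[k] H from m))

/-- A colinear map factors through an injective comodule iff it is the trace of a linear map. -/
theorem factorsThroughInjective_iff_trace (hne : Λ ≠ 0) {M N : Comod k H} (f : M ⟶ N) :
    FactorsThroughInjective f ↔ ∃ g, hΛ.trace g = f := by
  constructor
  · intro h
    obtain ⟨p, rfl⟩ := (factorsThroughInjective_iff f).1 h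
    obtain ⟨g, hg⟩ := hΛ.exists_trace_eq_id_cofree hne M.carrier
    -- The map is `ρ` followed by `p`. Inserting the identity of `M ⊗ H` between them, written as a
    -- trace, makes the composite a trace.
    refine ⟨p.lin ∘ₗ g ∘ₗ M.coactHom.lin, ?_⟩
    have e : M.coactHom ≫ hΛ.trace g ≫ p = M.coactHom ≫ p := by rw [hg, Category.id_comp]
    rw [trace_comp, comp_trace] at e
    exact e
  · rintro ⟨g, rfl⟩
    exact hΛ.trace_factors g

include hΛ in
/-- Over a co-Frobenius Hopf algebra, injective comodules are projective. -/
theorem exists_lift (hne : Λ ≠ 0) {I Y C : Comod k H} (hI : Injective I) (p : I ⟶ C) (q : Y ⟶ C)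
    (hq : Function.Surjective q.lin) : ∃ l : I ⟶ Y, l ≫ q = p := by
  obtain ⟨g, hg⟩ := (hΛ.factorsThroughInjective_iff_trace hne (𝟙 I)).1
    ⟨I, hI, 𝟙 _, 𝟙 _, Category.comp_id _⟩
  -- The section `s` is only linear. Since the identity of `I` is the trace of `g`, averaging `s ∘ p
  -- ∘ g` gives a colinear lift: composing with `q` leaves the trace of `p ∘ g`, which is `p`.
  obtain ⟨s, hs⟩ := q.lin.exists_rightInverse_of_surjective (LinearMap.range_eq_top.2 hq)
  refine ⟨hΛ.trace (s ∘ₗ p.lin ∘ₗ g), ?_⟩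
  rw [trace_comp, ← LinearMap.comp_assoc, hs, LinearMap.id_comp, ← trace_comp, hg,
    Category.id_comp]

/-! ### Tensor products -/

/-- `n₀ Λ(a n₁ S(h n₂)) = Λ(a S(h)) n`. -/
theorem sum_pairing_mul (Λ : H →ₗ[k] k) (N : Comod k H) (a h : H) (n : N.carrier) :
    TensorProduct.rid k N.carrier ((TensorProduct.lift ((pairing Λ ∘ₗ LinearMap.mulLeft k a).compl₂
      (LinearMap.mulLeft k h))).lTensor N.carrier
        (Coalgebra.comul.lTensor N.carrier (N.coact n))) = Λ (a * HopfAlgebra.antipode k h) • n := by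
  have e : ∀ z : H ⊗[k] H, TensorProduct.lift ((pairing Λ ∘ₗ LinearMap.mulLeft k a).compl₂
      (LinearMap.mulLeft k h)) z =
      Λ (a * LinearMap.mul' k H ((HopfAlgebra.antipode k).lTensor H z) *
        HopfAlgebra.antipode k h) := by
    intro z
    induction z with
    | zero => simp
    | add a b ha hb => simp only [map_add, mul_add, add_mul, ha, hb]
    | tmul a b => simp [mul_assoc, HopfAlgebra.antipode_mul_antidistrib]
  conv_rhs => rw [← N.counit n]
  generalize N.coact n = w
  induction w with
  | zero => simp
  | add a b ha hb => simp only [map_add, smul_add, ha, hb]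
  | tmul n c =>
    rw [LinearMap.lTensor_tmul, LinearMap.lTensor_tmul, e,
      HopfAlgebra.mul_antipode_lTensor_comul_apply]
    simp [Algebra.algebraMap_eq_smul_one, smul_smul, mul_comm]

/-- The left side is `m₀ ⊗ n₀ Λ(m₁ n₁ S(h n₂))`. As `S(h n₂) = S(n₂) S(h)`, the factors `n₁ S(n₂)`
meet and cancel; this depends on the second tensor factor standing on the right. -/
theorem average_tensor (Λ : H →ₗ[k] k) (M N : Comod k H) (m : M.carrier) (h : H)
    (n : N.carrier) :
    average Λ (tensorCoact M N) ((TensorProduct.assoc k M.carrier N.carrier H).symm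
      (m ⊗ₜ (LinearMap.mulLeft k h).lTensor N.carrier (N.coact n))) =
      average Λ M.coact (m ⊗ₜ h) ⊗ₜ n := by
  let G (z : M.carrier ⊗[k] H) : N.carrier ⊗[k] H →ₗ[k] M.carrier ⊗[k] N.carrier :=
    (TensorProduct.rid k _).toLinearMap ∘ₗ (TensorProduct.lift (pairing Λ)).lTensor _ ∘ₗ
      (TensorProduct.assoc k _ H H).toLinearMap ∘ₗ
      (mulTensor M.carrier N.carrier H ∘ₗ TensorProduct.mk k _ _ z ∘ₗ N.coact).rTensor H ∘ₗ
      (LinearMap.mulLeft k h).lTensor N.carrier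
  have e1 : ∀ w, average Λ (tensorCoact M N) ((TensorProduct.assoc k M.carrier N.carrier H).symm
      (m ⊗ₜ (LinearMap.mulLeft k h).lTensor N.carrier w)) = G (M.coact m) w := by
    intro w
    induction w with
    | zero => simp
    | add a b ha hb => simp only [map_add, tmul_add, ha, hb]
    | tmul p c => simp [G, average, tensorCoact]
  have e2 : ∀ q a w, G (q ⊗ₜ a) w = q ⊗ₜ TensorProduct.rid k N.carrier
      ((TensorProduct.lift ((pairing Λ ∘ₗ LinearMap.mulLeft k a).compl₂
        (LinearMap.mulLeft k h))).lTensor N.carrier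
          (TensorProduct.assoc k N.carrier H H (N.coact.rTensor H w))) := by
    intro q a w
    induction w with
    | zero => simp
    | add a b ha hb => simp only [map_add, tmul_add, ha, hb]
    | tmul p c =>
      simp only [G, LinearMap.comp_apply, LinearMap.lTensor_tmul, LinearMap.rTensor_tmul,
        TensorProduct.mk_apply, LinearEquiv.coe_coe]
      generalize N.coact p = y
      induction y with
      | zero => simp
      | add a b ha hb => simp only [map_add, tmul_add, add_tmul, ha, hb]
      | tmul b d => simp
  rw [e1, average_tmul]
  generalize M.coact m = z
  induction z with
  | zero => simp [G]
  | add a b ha hb =>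
    have : G (a + b) = G a + G b := by
      simp only [G, map_add, LinearMap.comp_add, LinearMap.add_comp, LinearMap.rTensor_add]
    rw [this, LinearMap.add_apply, ha, hb, map_add, map_add, add_tmul]
  | tmul q a =>
    rw [e2, N.coassoc, sum_pairing_mul]
    simp [smul_tmul]

/-- Together with the trace criterion this shows that tensoring on the right preserves maps through
injectives, without showing that `I ⊗ P` is injective for injective `I`. -/
theorem trace_rTensor {M N : Comod k H} (P : Comod k H) (g : M.carrier →ₗ[k] N.carrier) :
    hΛ.trace (M := tensor M P) (N := tensor N P) (g.rTensor P.carrier) =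
      (tensorRight P).map (hΛ.trace g) := by
  have e : ∀ x : M.carrier ⊗[k] P.carrier, average Λ (tensorCoact N P)
      ((g.rTensor P.carrier).rTensor H (tensorCoact M P x)) =
        (average Λ N.coact ∘ₗ g.rTensor H ∘ₗ M.coact).rTensor P.carrier x := by
    intro x
    induction x with
    | zero => simp
    | add a b ha hb => simp only [map_add, ha, hb]
    | tmul m n =>
      simp only [tensorCoact, LinearMap.comp_apply, map_tmul, LinearMap.rTensor_tmul]
      rw [← tensorCoact]
      generalize M.coact m = z
      induction z with
      | zero => simp
      | add a b ha hb => simp only [map_add, add_tmul, ha, hb]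
      | tmul a b =>
        rw [LinearMap.rTensor_tmul, ← average_tensor]
        generalize P.coact n = w
        induction w with
        | zero => simp
        | add a b ha hb => simp only [map_add, tmul_add, ha, hb]
        | tmul c d => simp
  exact hom_ext e

end IsLeftIntegral

/-! ## The right integral `Λ ∘ S` is nonzero -/

/-- The map `b ⊗ y ↦ S(S(b) y) d`. -/
def antipodeMul (d : H) : H ⊗[k] H →ₗ[k] H :=
  LinearMap.mulRight k d ∘ₗ HopfAlgebra.antipode k ∘ₗ LinearMap.mul' k H ∘ₗ
    (HopfAlgebra.antipode k).rTensor H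

theorem antipodeMul_comul (d b : H) :
    antipodeMul (k := k) d (Coalgebra.comul b) = Coalgebra.counit (R := k) b • d := by
  simp only [antipodeMul, LinearMap.comp_apply, HopfAlgebra.mul_antipode_rTensor_comul_apply]
  simp [Algebra.algebraMap_eq_smul_one, HopfAlgebra.antipode_one]

/-- The map `a ⊗ y ↦ Λ(y S(S²(a) c))`. -/
def twistedPairing (Λ : H →ₗ[k] k) (c : H) : H ⊗[k] H →ₗ[k] k :=
  TensorProduct.lift ((pairing Λ).flip ∘ₗ LinearMap.mulRight k c ∘ₗ HopfAlgebra.antipode k ∘ₗ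
    HopfAlgebra.antipode k)

/-- The map `h ↦ Λ(x₂ S(S²(x₁) h))`. -/
def twistedIntegral (Λ : H →ₗ[k] k) (x : H) : H →ₗ[k] k where
  toFun c := twistedPairing Λ c (Coalgebra.comul x)
  map_add' c c' := by
    generalize Coalgebra.comul (R := k) x = z
    induction z with
    | zero => simp
    | add a b ha hb => simp only [map_add, ha, hb]; abel
    | tmul a b => simp [twistedPairing, mul_add]
  map_smul' r c := by
    generalize Coalgebra.comul (R := k) x = z
    induction z with
    | zero => simp
    | add a b ha hb => simp only [map_add, ha, hb, smul_add]
    | tmul a b => simp [twistedPairing]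

theorem twistedIntegral_apply (Λ : H →ₗ[k] k) (x c : H) :
    twistedIntegral Λ x c = twistedPairing Λ c (Coalgebra.comul x) := rfl

/-- The map `(a ⊗ b) ⊗ (y ⊗ u) ↦ Λ(u S(S²(a) c)) S(S(b) y) d`. -/
def twistedProduct (Λ : H →ₗ[k] k) (c d : H) : (H ⊗[k] H) ⊗[k] (H ⊗[k] H) →ₗ[k] H :=
  (TensorProduct.rid k H).toLinearMap ∘ₗ
    TensorProduct.map (antipodeMul d) (twistedPairing Λ c) ∘ₗ
    (TensorProduct.tensorTensorTensorComm k H H H H).toLinearMap ∘ₗ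
    (TensorProduct.comm k H H).toLinearMap.rTensor (H ⊗[k] H)

/-- On `x₁ ⊗ x₂ ⊗ x₃ ⊗ x₄` the two middle factors enter only through `S(S(x₂) x₃)`, which collapses
to the counit. -/
theorem twistedProduct_comul (Λ : H →ₗ[k] k) (c d x : H) :
    twistedProduct Λ c d (TensorProduct.map Coalgebra.comul Coalgebra.comul
      (Coalgebra.comul (R := k) x)) = twistedPairing Λ c (Coalgebra.comul x) • d := by
  have e1 : ∀ (a : H) (t : H ⊗[k] H), twistedProduct Λ c d (Coalgebra.comul.lTensor (H ⊗[k] H)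
      ((TensorProduct.assoc k H H H).symm (a ⊗ₜ t))) =
      TensorProduct.rid k H (TensorProduct.map (antipodeMul d)
        (twistedPairing Λ c ∘ₗ TensorProduct.mk k H H a)
        ((TensorProduct.assoc k H H H).symm (Coalgebra.comul.lTensor H t))) := by
    intro a t
    induction t with
    | zero => simp
    | add a b ha hb => simp only [map_add, tmul_add, ha, hb]
    | tmul b y =>
      simp only [assoc_symm_tmul, LinearMap.lTensor_tmul]
      generalize Coalgebra.comul (R := k) y = z
      induction z with
      | zero => simp
      | add a b ha hb => simp only [map_add, tmul_add, ha, hb]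
      | tmul y u => simp [twistedProduct]
  have e2 : ∀ (φ : H →ₗ[k] k) (t : H ⊗[k] H), TensorProduct.rid k H
      (TensorProduct.map (antipodeMul d) φ (Coalgebra.comul.rTensor H t)) =
      φ (TensorProduct.lid k H ((Coalgebra.counit (R := k)).rTensor H t)) • d := by
    intro φ t
    induction t with
    | zero => simp
    | add a b ha hb => simp only [map_add, add_smul, ha, hb]
    | tmul b y => simp [antipodeMul_comul, smul_smul, mul_comm]
  rw [← LinearMap.lTensor_comp_rTensor, LinearMap.comp_apply, ← Coalgebra.coassoc_symm_apply]
  generalize Coalgebra.comul (R := k) x = z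
  induction z with
  | zero => simp
  | add a b ha hb => simp only [map_add, add_smul, ha, hb]
  | tmul a y =>
    rw [LinearMap.lTensor_tmul, e1, Coalgebra.coassoc_symm_apply, e2,
      Coalgebra.rTensor_counit_comul]
    simp

/-- `R` is a right integral: `R(h₁) h₂ = R(h) 1`. -/
def IsRightIntegral (R : H →ₗ[k] k) : Prop :=
  ∀ h : H, TensorProduct.lid k H (R.rTensor H (Coalgebra.comul h)) = R h • (1 : H)

open WithConv LinearMap in
/-- `S(y₁) y₂ Λ(y₃ S(h)) = Λ(y S(h)) 1`. -/
theorem antipode_mul_slideLeft (Λ : H →ₗ[k] k) (y h : H) :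
    LinearMap.mul' k H (TensorProduct.map (HopfAlgebra.antipode k)
      (slideLeft Λ ∘ₗ (TensorProduct.mk k H H).flip h) (Coalgebra.comul (R := k) y)) =
      pairing Λ y h • 1 := by
  let G : H →ₗ[k] H := Algebra.linearMap k H ∘ₗ (pairing Λ).flip h
  have h1 : toConv (slideLeft Λ ∘ₗ (TensorProduct.mk k H H).flip h) =
      toConv LinearMap.id * toConv G := by
    ext c
    rw [LinearMap.convMul_apply]
    refine (slideLeft_tmul Λ c h).trans ?_
    generalize Coalgebra.comul (R := k) c = z
    induction z with
    | zero => simp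
    | add a b ha hb => simp only [map_add, ha, hb]
    | tmul a b => simp [G, Algebra.algebraMap_eq_smul_one]
  -- The slid map is the convolution `id * G`, so convolving with `S` on the left leaves `G`.
  have h2 : toConv (HopfAlgebra.antipode k) *
      toConv (slideLeft Λ ∘ₗ (TensorProduct.mk k H H).flip h) = toConv G := by
    rw [h1, ← mul_assoc, LinearMap.antipode_mul_id, one_mul]
  have h3 := congrArg (fun g => g.ofConv y) h2
  simp only [LinearMap.convMul_apply] at h3
  exact h3.trans (Algebra.algebraMap_eq_smul_one _)

namespace IsLeftIntegral

variable {Λ : H →ₗ[k] k} (hΛ : IsLeftIntegral Λ)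

include hΛ in
-- Write the scalar as `S(y₁) y₂ Λ(y₃ S(S²(a) h))` and apply `slide`. Since `S²` respects `Δ`, what
-- remains is `Λ(y₂ S(S²(a₁) h₁)) S(y₁) S²(a₂) h₂`, and `S(y₁) S²(a₂) = S(S(a₂) y₁)`. The expansion
-- of `Δ(h)` is fixed because its two legs enter `twistedProduct` as parameters.
theorem twistedPairing_smul_one (a y h : H) {ι : Type*} (s : Finset ι) (c d : ι → H)
    (hs : Coalgebra.comul (R := k) h = ∑ i ∈ s, c i ⊗ₜ d i) :
    twistedPairing Λ h (a ⊗ₜ y) • (1 : H) =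
      ∑ i ∈ s, twistedProduct Λ (c i) (d i) (Coalgebra.comul a ⊗ₜ Coalgebra.comul y) := by
  have e0 : twistedPairing Λ h (a ⊗ₜ y) =
      pairing Λ y (HopfAlgebra.antipode k (HopfAlgebra.antipode k a) * h) := by
    simp [twistedPairing]
  rw [e0, ← antipode_mul_slideLeft]
  generalize Coalgebra.comul (R := k) y = z
  induction z with
  | zero => simp
  | add a b ha hb => simp only [map_add, tmul_add, ha, hb, Finset.sum_add_distrib]
  | tmul y u =>
    simp only [TensorProduct.map_tmul, LinearMap.comp_apply, LinearMap.flip_apply,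
      TensorProduct.mk_apply, slideLeft_tmul]
    rw [hΛ.slide, Bialgebra.comul_mul, hs, comul_antipode, comul_antipode]
    generalize Coalgebra.comul (R := k) a = z
    induction z with
    | zero => simp
    | add a b ha hb =>
      simp only [map_add, add_mul, tmul_add, add_tmul, ha, hb, Finset.sum_add_distrib]
    | tmul a b =>
      simp [Finset.mul_sum, twistedProduct, twistedPairing, antipodeMul, mul_assoc,
        HopfAlgebra.antipode_mul_antidistrib]

include hΛ in
/-- `h ↦ Λ(x₂ S(h) S³(x₁))` is a right integral. -/
theorem twistedIntegral_isRightIntegral (x : H) : IsRightIntegral (twistedIntegral Λ x) := by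
  intro h
  obtain ⟨ι, s, c, d, hs⟩ : ∃ (ι : Type _) (s : Finset ι) (c d : ι → H),
      Coalgebra.comul (R := k) h = ∑ i ∈ s, c i ⊗ₜ d i :=
    ⟨_, _, _, _, (Coalgebra.Repr.arbitrary k h).eq.symm⟩
  -- At `z = Δ(x)` the right side has the four-fold coproduct of `x` as input, so
  -- `twistedProduct_comul` reduces it to the sum for `R(h₁) h₂`.
  have e : ∀ z : H ⊗[k] H, twistedPairing Λ h z • (1 : H) = ∑ i ∈ s,
      twistedProduct Λ (c i) (d i) (TensorProduct.map Coalgebra.comul Coalgebra.comul z) := by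
    intro z
    induction z with
    | zero => simp
    | add a b ha hb => simp only [map_add, add_smul, ha, hb, Finset.sum_add_distrib]
    | tmul a y => exact hΛ.twistedPairing_smul_one a y h s c d hs
  simp only [twistedIntegral_apply]
  rw [e, hs, map_sum, map_sum]
  refine Finset.sum_congr rfl fun i _ => ?_
  rw [twistedProduct_comul]
  simp [twistedIntegral_apply]

include hΛ in
/-- `R(h) Λ(x) = R(x h₁) Λ(S(h₂))` for a right integral `R`, so `R` vanishes if `Λ ∘ S` does. -/
theorem eq_zero_of_comp_antipode (hne : Λ ≠ 0) (h0 : Λ ∘ₗ HopfAlgebra.antipode k = 0)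
    {R : H →ₗ[k] k} (hR : IsRightIntegral R) : R = 0 := by
  obtain ⟨x, hx⟩ : ∃ x, Λ x = 1 := LinearMap.surjective hne 1
  -- For `z = y ⊗ b` the value is `R(y₁) Λ(y₂ S(b)) = R(y) Λ(S(b))`, which vanishes. By
  -- `average_comul`, every element of `H` has the form `average Λ Δ z`.
  have e : ∀ z : H ⊗[k] H, R (average Λ Coalgebra.comul z) = 0 := by
    intro z
    induction z with
    | zero => simp
    | add a b ha hb => rw [map_add, map_add, ha, hb, add_zero]
    | tmul y b =>
      have e1 : R (average Λ Coalgebra.comul (y ⊗ₜ b)) = Λ (TensorProduct.lid k H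
          (R.rTensor H (Coalgebra.comul y)) * HopfAlgebra.antipode k b) := by
        rw [average_tmul]
        generalize Coalgebra.comul (R := k) y = w
        induction w with
        | zero => simp
        | add a b ha hb => simp only [map_add, add_mul, ha, hb]
        | tmul a c => simp [mul_comm]
      rw [e1, hR y, smul_mul_assoc, one_mul, map_smul]
      have : Λ (HopfAlgebra.antipode k b) = 0 := LinearMap.congr_fun h0 b
      rw [this, smul_zero]
  ext h
  have := e ((LinearMap.mulLeft k x).rTensor H (Coalgebra.comul h))
  rwa [hΛ.average_comul, hx, one_smul] at this

include hΛ in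
/-- If `Λ` is a nonzero left integral then `Λ ∘ S` is nonzero. -/
theorem comp_antipode_ne_zero (hne : Λ ≠ 0) : Λ ∘ₗ HopfAlgebra.antipode (A := H) k ≠ 0 := by
  intro h0
  have h1 : ∀ x c : H, twistedPairing Λ c (Coalgebra.comul x) = 0 := by
    intro x c
    rw [← twistedIntegral_apply, hΛ.eq_zero_of_comp_antipode hne h0
      (hΛ.twistedIntegral_isRightIntegral x), LinearMap.zero_apply]
  refine hne (LinearMap.ext fun x => ?_)
  -- The vanishing twisted integral of `y` at `S(a)` reads `Λ(y₂ S²(a S(y₁))) = 0`. For `a ⊗ y =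
  -- Δ(x)` the argument `x₃ S²(x₁ S(x₂))` collapses to `x`, which forces `Λ(x) = 0`.
  have e1 : ∀ z : H ⊗[k] H, Λ (LinearMap.mul' k H (TensorProduct.comm k H H
      ((HopfAlgebra.antipode k ∘ₗ HopfAlgebra.antipode k ∘ₗ LinearMap.mul' k H ∘ₗ
        (HopfAlgebra.antipode k).lTensor H).rTensor H
        ((TensorProduct.assoc k H H H).symm (Coalgebra.comul.lTensor H z))))) = 0 := by
    intro z
    induction z with
    | zero => simp
    | add a b ha hb => simp only [map_add, ha, hb, add_zero]
    | tmul a y =>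
      rw [← h1 y (HopfAlgebra.antipode k a), LinearMap.lTensor_tmul]
      generalize Coalgebra.comul (R := k) y = w
      induction w with
      | zero => simp
      | add a b ha hb => simp only [map_add, tmul_add, ha, hb]
      | tmul b y => simp [twistedPairing, HopfAlgebra.antipode_mul_antidistrib]
  have e2 : ∀ z : H ⊗[k] H, LinearMap.mul' k H (TensorProduct.comm k H H
      ((HopfAlgebra.antipode k ∘ₗ HopfAlgebra.antipode k ∘ₗ LinearMap.mul' k H ∘ₗ
        (HopfAlgebra.antipode k).lTensor H).rTensor H (Coalgebra.comul.rTensor H z))) =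
      TensorProduct.lid k H ((Coalgebra.counit (R := k)).rTensor H z) := by
    intro z
    induction z with
    | zero => simp
    | add a b ha hb => simp only [map_add, ha, hb]
    | tmul a y =>
      simp only [LinearMap.rTensor_tmul, LinearMap.comp_apply,
        HopfAlgebra.mul_antipode_lTensor_comul_apply]
      simp [Algebra.algebraMap_eq_smul_one, HopfAlgebra.antipode_one]
  have := e1 (Coalgebra.comul x)
  rwa [Coalgebra.coassoc_symm_apply, e2, Coalgebra.rTensor_counit_comul, lid_tmul, one_smul] at this

end IsLeftIntegral

/-! ## Short exact sequences of comodules -/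

namespace Comod

/-- A colinear map into `J` with values in the image of a monomorphism `N → J` lifts to `N`. -/
theorem exists_lift_of_range_le {M N J : Comod k H} (ι : N ⟶ J)
    (hι : Function.Injective ι.lin) (f : M ⟶ J) (h : ∀ m, f.lin m ∈ LinearMap.range ι.lin) :
    ∃ l : M ⟶ N, l ≫ ι = f := by
  let e := LinearEquiv.ofInjective ι.lin hι
  let l : M.carrier →ₗ[k] N.carrier := e.symm.toLinearMap ∘ₗ f.lin.codRestrict _ h
  have hl : ∀ m, ι.lin (l m) = f.lin m := fun m =>
    LinearEquiv.ofInjective_symm_apply ι.lin (h := hι) (f.lin.codRestrict _ h m)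
  refine ⟨⟨l, fun m => ?_⟩, hom_ext hl⟩
  -- Colinearity of the linear lift may be tested after the injection of `N ⊗ H` into `J ⊗ H`.
  apply Module.Flat.rTensor_preserves_injective_linearMap (M := H) ι.lin hι
  rw [← LinearMap.rTensor_comp_apply, ι.colinear, hl, ← f.colinear]
  congr 2
  exact LinearMap.ext hl

theorem injective_of_bijective {M N : Comod k H} (f : M ⟶ N) (hf : Function.Bijective f.lin)
    [Injective N] : Injective M := by
  obtain ⟨g, hg⟩ := exists_lift_of_range_le f hf.1 (𝟙 N) fun n => hf.2 n
  have hm : Mono f := mono_of_injective f hf.1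
  have ret : Retract M N := ⟨f, g, (cancel_mono f).1 (by
    rw [Category.assoc, hg, Category.comp_id, Category.id_comp])⟩
  exact ret.injective

/-- `0 → X → Y → Z → 0` is exact. -/
structure IsShortExact {X Y Z : Comod k H} (i : X ⟶ Y) (p : Y ⟶ Z) : Prop where
  injective : Function.Injective i.lin
  exact : Function.Exact i.lin p.lin
  surjective : Function.Surjective p.lin

theorem IsShortExact.exists_lift {W X Y Z : Comod k H} {i : X ⟶ Y} {p : Y ⟶ Z}
    (h : IsShortExact i p) (f : W ⟶ Y) (hf : f ≫ p = 0) : ∃ l : W ⟶ X, l ≫ i = f :=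
  exists_lift_of_range_le i h.injective f fun m =>
    (h.exact _).1 (congrArg (fun g => g.lin m) hf)

theorem isShortExact_cokerπ {X Y : Comod k H} (i : X ⟶ Y) (hi : Function.Injective i.lin) :
    IsShortExact i (cokerπ i) :=
  ⟨hi, LinearMap.exact_map_mkQ_range i.lin, Submodule.mkQ_surjective _⟩

theorem coactHom_injective (M : Comod k H) : Function.Injective M.coactHom.lin :=
  injective_of_mono _

/-- The map `id ⊗ f : N ⊗ P → N ⊗ Q`. -/
def tensorLeftMap (N : Comod k H) {P Q : Comod k H} (f : P ⟶ Q) : tensor N P ⟶ tensor N Q :=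
  ⟨f.lin.lTensor N.carrier, by
    have e : ∀ x : N.carrier ⊗[k] P.carrier,
        (f.lin.lTensor N.carrier).rTensor H (tensorCoact N P x) =
          tensorCoact N Q (f.lin.lTensor N.carrier x) := by
      intro x
      induction x with
      | zero => simp
      | add a b ha hb => simp only [map_add, ha, hb]
      | tmul m n =>
        simp only [LinearMap.lTensor_tmul, tensorCoact, LinearMap.comp_apply, map_tmul]
        rw [← f.colinear]
        generalize N.coact m = p
        generalize P.coact n = q
        induction p with
        | zero => simp
        | add a a' ha ha' => simp only [map_add, add_tmul, ha, ha']
        | tmul m x =>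
          induction q with
          | zero => simp
          | add a a' ha ha' => simp only [map_add, tmul_add, ha, ha']
          | tmul n y => simp
    exact e⟩

/-- The map `f ⊗ id : M ⊗ P → N ⊗ P`. -/
def tensorRightMap {M N : Comod k H} (f : M ⟶ N) (P : Comod k H) : tensor M P ⟶ tensor N P :=
  (tensorRight P).map f

theorem tensorLeftMap_natural {M N P Q : Comod k H} (g : M ⟶ N) (f : P ⟶ Q) :
    tensorRightMap g P ≫ tensorLeftMap N f = tensorLeftMap M f ≫ tensorRightMap g Q :=
  Hom.ext ((LinearMap.lTensor_comp_rTensor ..).trans (LinearMap.rTensor_comp_lTensor ..).symm)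

/-! ### The tensor product with the regular comodule -/

/-- The map `n ⊗ h ↦ n₀ ⊗ g(n₁) h`. -/
def shear {V : Type v} [AddCommGroup V] [Module k V] (ρ : V →ₗ[k] V ⊗[k] H) (g : H →ₗ[k] H) :
    V ⊗[k] H →ₗ[k] V ⊗[k] H :=
  (LinearMap.mul' k H ∘ₗ g.rTensor H).lTensor V ∘ₗ (TensorProduct.assoc k V H H).toLinearMap ∘ₗ
    ρ.rTensor H

/-- The hypothesis says that `g` and `g'` convolve to the unit, and the composite of the two shears
is `m ⊗ c ↦ m₀ ⊗ g(m₁) g'(m₂) c`. -/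
theorem shear_shear (M : Comod k H) (g g' : H →ₗ[k] H)
    (h : ∀ a : H, LinearMap.mul' k H (TensorProduct.map g g' (Coalgebra.comul (R := k) a)) =
      algebraMap k H (Coalgebra.counit a)) (x : M.carrier ⊗[k] H) :
    shear M.coact g (shear M.coact g' x) = x := by
  induction x with
  | zero => simp
  | add a b ha hb => simp only [map_add, ha, hb]
  | tmul m c =>
    have e1 : ∀ z : M.carrier ⊗[k] H, shear M.coact g
        ((LinearMap.mul' k H ∘ₗ g'.rTensor H).lTensor M.carrier
          (TensorProduct.assoc k M.carrier H H (z ⊗ₜ c))) =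
        (LinearMap.mulRight k c ∘ₗ LinearMap.mul' k H ∘ₗ TensorProduct.map g g').lTensor M.carrier
          (TensorProduct.assoc k M.carrier H H (M.coact.rTensor H z)) := by
      intro z
      induction z with
      | zero => simp
      | add a b ha hb => simp only [map_add, add_tmul, ha, hb]
      | tmul m a =>
        simp only [assoc_tmul, LinearMap.lTensor_tmul, LinearMap.rTensor_tmul, shear,
          LinearMap.comp_apply, LinearEquiv.coe_coe]
        generalize M.coact m = w
        induction w with
        | zero => simp
        | add a b ha hb => simp only [map_add, add_tmul, ha, hb]
        | tmul m b => simp [mul_assoc]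
    have e2 : ∀ z : M.carrier ⊗[k] H, (LinearMap.mulRight k c ∘ₗ LinearMap.mul' k H ∘ₗ
        TensorProduct.map g g').lTensor M.carrier (Coalgebra.comul.lTensor M.carrier z) =
        TensorProduct.rid k M.carrier ((Coalgebra.counit (R := k)).lTensor M.carrier z) ⊗ₜ c := by
      intro z
      induction z with
      | zero => simp
      | add a b ha hb => simp only [map_add, add_tmul, ha, hb]
      | tmul m a =>
        simp only [LinearMap.lTensor_tmul, LinearMap.comp_apply, h]
        simp [Algebra.algebraMap_eq_smul_one, smul_tmul]
    refine (e1 _).trans ?_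
    rw [M.coassoc, e2, M.counit]

theorem shear_colinear (M : Comod k H) (x : M.carrier ⊗[k] H) :
    (shear M.coact LinearMap.id).rTensor H
        (mulTensor M.carrier H H (TensorProduct.map M.coact Coalgebra.comul x)) =
      cofreeCoact k H M.carrier (shear M.coact LinearMap.id x) := by
  induction x with
  | zero => simp
  | add a b ha hb => simp only [map_add, ha, hb]
  | tmul m h =>
    have e1 : ∀ (z : M.carrier ⊗[k] H) (w : H ⊗[k] H), (shear M.coact LinearMap.id).rTensor H
        (mulTensor M.carrier H H (z ⊗ₜ w)) = (TensorProduct.assoc k M.carrier H H).symm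
          ((LinearMap.mulRight k w).lTensor M.carrier
            (TensorProduct.assoc k M.carrier H H (M.coact.rTensor H z))) := by
      intro z w
      induction z with
      | zero => simp
      | add a b ha hb => simp only [map_add, add_tmul, ha, hb]
      | tmul m a =>
        simp only [LinearMap.rTensor_tmul]
        induction w with
        | zero => simp
        | add c d ha hb =>
          have : LinearMap.mulRight k (c + d) = LinearMap.mulRight k c + LinearMap.mulRight k d :=
            LinearMap.ext fun x => mul_add x c d
          rw [tmul_add, map_add, map_add, ha, hb, this, LinearMap.lTensor_add,
            LinearMap.add_apply, map_add]
        | tmul c d =>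
          simp only [mulTensor_tmul, LinearMap.rTensor_tmul, shear, LinearMap.comp_apply]
          generalize M.coact m = y
          induction y with
          | zero => simp
          | add a b ha hb => simp only [map_add, add_tmul, ha, hb]
          | tmul m b => simp
    have e2 : ∀ z : M.carrier ⊗[k] H, (TensorProduct.assoc k M.carrier H H).symm
        ((LinearMap.mulRight k (Coalgebra.comul h)).lTensor M.carrier
          (Coalgebra.comul.lTensor M.carrier z)) = cofreeCoact k H M.carrier
        ((LinearMap.mul' k H ∘ₗ LinearMap.id.rTensor H).lTensor M.carrier
          (TensorProduct.assoc k M.carrier H H (z ⊗ₜ h))) := by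
      intro z
      induction z with
      | zero => simp
      | add a b ha hb => simp only [map_add, add_tmul, ha, hb]
      | tmul m a => simp [cofreeCoact]
    refine (e1 (M.coact m) (Coalgebra.comul h)).trans ?_
    rw [M.coassoc, e2]
    rfl

theorem shear_bijective (M : Comod k H) : Function.Bijective (shear M.coact LinearMap.id) :=
  ⟨Function.LeftInverse.injective (g := shear M.coact (HopfAlgebra.antipode k))
      (shear_shear M _ _ HopfAlgebra.mul_antipode_rTensor_comul_apply),
    Function.RightInverse.surjective (g := shear M.coact (HopfAlgebra.antipode k))
      (shear_shear M _ _ HopfAlgebra.mul_antipode_lTensor_comul_apply)⟩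

/-- The shear `m ⊗ h ↦ m₀ ⊗ m₁ h`, with inverse `m ⊗ h ↦ m₀ ⊗ S(m₁) h`, untwists the diagonal
coaction into the cofree one. -/
instance tensor_regular_injective (M : Comod k H) : Injective (tensor M (regular k H)) :=
  injective_of_bijective (N := cofree k H M.carrier)
    ⟨show M.carrier ⊗[k] H →ₗ[k] M.carrier ⊗[k] H from shear M.coact LinearMap.id,
      shear_colinear M⟩ (shear_bijective M)

end Comod

/-! ### The short exact sequence `0 → T'(N) → N ⊗ H → N → 0` -/

namespace IsLeftIntegral

variable {Λ : H →ₗ[k] k} (hΛ : IsLeftIntegral Λ)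

/-- The map `n ⊗ h ↦ Λ(S(h)) n`. -/
def evalRegular (N : Comod k H) : tensor N (regular k H) ⟶ N :=
  ⟨(TensorProduct.rid k N.carrier).toLinearMap ∘ₗ
      (Λ ∘ₗ HopfAlgebra.antipode (A := H) k).lTensor N.carrier, by
    have e : ∀ x : N.carrier ⊗[k] H, ((TensorProduct.rid k N.carrier).toLinearMap ∘ₗ
        (Λ ∘ₗ HopfAlgebra.antipode (A := H) k).lTensor N.carrier).rTensor H
          (mulTensor N.carrier H H (TensorProduct.map N.coact Coalgebra.comul x)) = N.coact (TensorProduct.rid k N.carrier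
            ((Λ ∘ₗ HopfAlgebra.antipode (A := H) k).lTensor N.carrier x)) := by
      intro x
      induction x with
      | zero => simp
      | add a b ha hb => simp only [map_add, ha, hb]
      | tmul n h =>
        have e1 : ∀ (z : N.carrier ⊗[k] H) (w : H ⊗[k] H),
            ((TensorProduct.rid k N.carrier).toLinearMap ∘ₗ
              (Λ ∘ₗ HopfAlgebra.antipode (A := H) k).lTensor N.carrier).rTensor H
                (mulTensor N.carrier H H (z ⊗ₜ w)) =
            (LinearMap.mulRight k (TensorProduct.lid k H
              ((Λ ∘ₗ HopfAlgebra.antipode k).rTensor H w))).lTensor N.carrier z := by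
          intro z w
          induction z with
          | zero => simp
          | add a b ha hb => simp only [map_add, add_tmul, ha, hb]
          | tmul n a =>
            induction w with
            | zero => simp
            | add a b ha hb => simp only [map_add, tmul_add, ha, hb, LinearMap.lTensor_tmul,
                LinearMap.mulRight_apply, mul_add]
            | tmul c d => simp [smul_tmul]
        refine (e1 (N.coact n) (Coalgebra.comul h)).trans ?_
        -- Colinearity of the evaluation is exactly the right integral property of `Λ ∘ S`.
        rw [hΛ.comp_antipode]
        have e2 : LinearMap.mulRight k (Λ (HopfAlgebra.antipode k h) • (1 : H)) =
            Λ (HopfAlgebra.antipode k h) • LinearMap.id := by ext; simp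
        rw [e2]
        simp
    exact e⟩

/-- The inclusion `Ker(Λ ∘ S) → H`. -/
def kerι : kerIntegral hΛ ⟶ regular k H := (regular k H).subι _ _

/-- This is `Ker(Λ ∘ S) → H → k` tensored with `N`. Surjectivity is where `Λ ∘ S` must be nonzero.
-/
theorem isShortExact_evalRegular (hne : Λ ≠ 0) (N : Comod k H) :
    IsShortExact (tensorLeftMap N hΛ.kerι) (hΛ.evalRegular N) where
  injective := Module.Flat.lTensor_preserves_injective_linearMap _ (Submodule.injective_subtype _)
  exact := by
    have h := Module.Flat.lTensor_exact N.carrier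
      (LinearMap.exact_subtype_ker_map (Λ ∘ₗ HopfAlgebra.antipode (A := H) k))
    intro x
    exact (LinearEquiv.map_eq_zero_iff (TensorProduct.rid k N.carrier)).trans (h x)
  surjective n := by
    obtain ⟨y, hy⟩ := LinearMap.surjective (hΛ.comp_antipode_ne_zero hne) 1
    exact ⟨n ⊗ₜ[k] y, by
      refine (TensorProduct.rid_tmul n ((Λ ∘ₗ HopfAlgebra.antipode k) y)).trans ?_
      rw [hy, one_smul]⟩

end IsLeftIntegral

/-! ## The functors `T` and `T'` are stably inverse to each other -/

theorem toStable_map_eq_of_factors {M N : Comod k H} {f g : M ⟶ N}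
    (h : FactorsThroughInjective (f - g)) : (toStable k H).map f = (toStable k H).map g :=
  CategoryTheory.Quotient.sound _ h

namespace IsLeftIntegral

variable {Λ : H →ₗ[k] k} (hΛ : IsLeftIntegral Λ)

/-- Half of Schanuel's argument: `L ≫ L' - 𝟙` is killed by `p`, so it equals `d ≫ i` for some `d : I
⟶ M`. Restricting to `M` gives `α ≫ β - 𝟙 = i ≫ d`, a map through `I`. -/
theorem factors_of_lift {M I C J N : Comod k H} {i : M ⟶ I} {p : I ⟶ C} {j : N ⟶ J} {q : J ⟶ C}
    (h : IsShortExact i p) (hI : Injective I)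
    {α : M ⟶ N} {β : N ⟶ M} {L : I ⟶ J} {L' : J ⟶ I} (hL : L ≫ q = p) (hL' : L' ≫ p = q)
    (hα : α ≫ j = i ≫ L) (hβ : β ≫ i = j ≫ L') : FactorsThroughInjective (α ≫ β - 𝟙 M) := by
  obtain ⟨d, hd⟩ := h.exists_lift (L ≫ L' - 𝟙 I) (by
    rw [Preadditive.sub_comp, Category.assoc, hL', hL, Category.id_comp, sub_self])
  have hm : Mono i := mono_of_injective _ h.injective
  refine ⟨I, hI, i, d, (cancel_mono i).1 ?_⟩
  rw [Category.assoc, hd, Preadditive.comp_sub, Preadditive.sub_comp, Category.assoc, hβ,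
    ← Category.assoc α, hα]
  simp

include hΛ in
/-- Two embeddings into injectives with the same cokernel have stably isomorphic sources. -/
theorem isIso_toStable_map (hne : Λ ≠ 0) {M I C J N : Comod k H} {i : M ⟶ I} {p : I ⟶ C}
    {j : N ⟶ J} {q : J ⟶ C} (h : IsShortExact i p) (h' : IsShortExact j q) (hI : Injective I)
    (hJ : Injective J) (α : M ⟶ N) (L : I ⟶ J) (hL : L ≫ q = p) (hα : α ≫ j = i ≫ L) :
    IsIso ((toStable k H).map α) := by
  -- The opposite comparison map exists because the injective `J` is also projective; its
  -- restriction `β` is the stable inverse.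
  obtain ⟨L', hL'⟩ := hΛ.exists_lift hne hJ q p h.surjective
  obtain ⟨β, hβ⟩ := h.exists_lift (j ≫ L') (by
    rw [Category.assoc, hL']
    exact hom_ext h'.exact.apply_apply_eq_zero)
  refine ⟨(toStable k H).map β, ?_, ?_⟩
  · rw [← Functor.map_comp]
    exact (toStable_map_eq_of_factors (factors_of_lift h hI hL hL' hα hβ)).trans
      ((toStable k H).map_id M)
  · rw [← Functor.map_comp]
    exact (toStable_map_eq_of_factors (factors_of_lift h' hJ hL' hL hβ hα)).trans
      ((toStable k H).map_id N)

/-! ### The natural map `M → T'(T(M))` -/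

/-- The linear map `m ⊗ h ↦ [m ⊗ x h] ⊗ y`. -/
def suspSection (x y : H) (M : Comod k H) :
    (cofree k H M.carrier).carrier →ₗ[k] (tensor (suspObj M) (regular k H)).carrier :=
  show M.carrier ⊗[k] H →ₗ[k] (suspObj M).carrier ⊗[k] H from
    (TensorProduct.mk k _ H).flip y ∘ₗ (cokerπ M.coactHom).lin ∘ₗ
      (LinearMap.mulLeft k x).lTensor M.carrier

/-- The natural lift `M ⊗ H → T(M) ⊗ H` of the projection `M ⊗ H → T(M)`. -/
def suspLift (x y : H) (M : Comod k H) :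
    cofree k H M.carrier ⟶ tensor (suspObj M) (regular k H) :=
  hΛ.trace (suspSection x y M)

/-- A lift from projectivity alone need not be natural. This one is, since it averages a linear map
given by a formula natural in `M`. -/
theorem suspLift_natural (x y : H) {M N : Comod k H} (f : M ⟶ N) :
    suspLift hΛ x y M ≫ tensorRightMap (suspMap f) (regular k H) =
      cofreeMap f ≫ suspLift hΛ x y N := by
  rw [suspLift, suspLift, trace_comp, comp_trace]
  congr 1
  refine TensorProduct.ext' fun m h => ?_
  rfl

/-- Inside the trace, evaluation removes `y` and leaves the projection after `id ⊗ (x ·)`. The trace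
of `id ⊗ (x ·)` is the identity. -/
theorem suspLift_eval {x y : H} (hx : Λ x = 1) (hy : Λ (HopfAlgebra.antipode k y) = 1)
    (M : Comod k H) : suspLift hΛ x y M ≫ hΛ.evalRegular (suspObj M) = cokerπ M.coactHom := by
  have e1 : hΛ.trace (M := cofree k H M.carrier) (N := cofree k H M.carrier)
      ((LinearMap.mulLeft k x).lTensor M.carrier) = 𝟙 _ := by
    ext m
    exact (hΛ.average_cofree x m).trans
      (by rw [hx]; exact one_smul k (show M.carrier ⊗[k] H from m))
  rw [suspLift, trace_comp]
  refine Eq.trans ?_ ((hΛ.trace_comp _ (cokerπ M.coactHom)).symm.trans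
    ((congrArg (· ≫ cokerπ M.coactHom) e1).trans (Category.id_comp _)))
  congr 1
  refine LinearMap.ext fun m => ?_
  let t : (suspObj M).carrier :=
    (cokerπ M.coactHom).lin ((LinearMap.mulLeft k x).lTensor M.carrier m)
  have e2 : TensorProduct.rid k (suspObj M).carrier
      (t ⊗ₜ Λ (HopfAlgebra.antipode k y)) = t := by rw [rid_tmul, hy, one_smul]
  exact e2

/-- There is a natural map `M → T'(T(M))` which is a stable isomorphism. -/
theorem exists_unit (hne : Λ ≠ 0) :
    ∃ α : 𝟭 (Comod k H) ⟶ suspension k H ⋙ desuspension hΛ,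
      ∀ M, IsIso ((toStable k H).map (α.app M)) := by
  obtain ⟨x, hx⟩ := LinearMap.surjective hne 1
  obtain ⟨y, hy⟩ := LinearMap.surjective (hΛ.comp_antipode_ne_zero hne) 1
  have hS (M : Comod k H) := isShortExact_cokerπ M.coactHom M.coactHom_injective
  have hE (M : Comod k H) := hΛ.isShortExact_evalRegular hne (suspObj M)
  have hex (M : Comod k H) := (hE M).exists_lift (M.coactHom ≫ suspLift hΛ x y M) (by
    rw [Category.assoc, hΛ.suspLift_eval hx hy, coker_condition])
  choose α hα using hex
  refine ⟨⟨α, fun M N f => ?_⟩, fun M => ?_⟩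
  -- The components of `α` were chosen separately, but each is determined by its composite with the
  -- embedding into `T(N) ⊗ H`, where naturality is that of the lift.
  · have hm : Mono (tensorLeftMap (suspObj N) hΛ.kerι) := mono_of_injective _ (hE N).injective
    refine (cancel_mono (tensorLeftMap (suspObj N) hΛ.kerι)).1 ?_
    have e1 : (f ≫ α N) ≫ tensorLeftMap (suspObj N) hΛ.kerι =
        (α M ≫ tensorRightMap (suspMap f) (kerIntegral hΛ)) ≫
          tensorLeftMap (suspObj N) hΛ.kerι := by
      rw [Category.assoc, Category.assoc, hα, tensorLeftMap_natural, ← Category.assoc (α M), hα, Category.assoc M.coactHom, suspLift_natural,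
        ← Category.assoc, ← Category.assoc, coactHom_naturality]
    exact e1
  · exact hΛ.isIso_toStable_map hne (hS M) (hE M) inferInstance inferInstance (α M)
      (suspLift hΛ x y M) (hΛ.suspLift_eval hx hy M) (hα M)

end IsLeftIntegral

/-! ## Stability -/

/-- `F` preserves maps that factor through an injective comodule. -/
def PreservesStablyZero (F : Comod k H ⥤ Comod k H) : Prop :=
  ∀ ⦃M N : Comod k H⦄ (f : M ⟶ N), FactorsThroughInjective f → FactorsThroughInjective (F.map f)

theorem suspension_preservesStablyZero : PreservesStablyZero (suspension k H) := by
  rintro M N f ⟨I, hI, a, b, rfl⟩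
  exact ⟨_, suspObj_injective I, suspMap a, suspMap b, (suspMap_comp a b).symm⟩

theorem IsLeftIntegral.desuspension_preservesStablyZero {Λ : H →ₗ[k] k} (hΛ : IsLeftIntegral Λ)
    (hne : Λ ≠ 0) : PreservesStablyZero (desuspension hΛ) := by
  intro M N f hf
  obtain ⟨g, rfl⟩ := (hΛ.factorsThroughInjective_iff_trace hne f).1 hf
  have := hΛ.trace_factors (M := tensor M (kerIntegral hΛ)) (N := tensor N (kerIntegral hΛ))
    (g.rTensor _)
  rwa [hΛ.trace_rTensor] at this

theorem PreservesStablyZero.iterate {F : Comod k H ⥤ Comod k H} (hF : PreservesStablyZero F) :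
    ∀ n, PreservesStablyZero (iterate F n)
  | 0 => fun _ _ _ h => h
  | n + 1 => fun _ _ f h => PreservesStablyZero.iterate hF n _ (hF f h)

instance : (suspension k H).Additive where
  map_add :=
    (AddMonoidHom.ofMapSub (fun f => suspMap f) suspMap_sub).map_add _ _

instance (P : Comod k H) : (tensorRight P).Additive where
  map_add := Hom.ext (LinearMap.rTensor_add ..)

instance {Λ : H →ₗ[k] k} (hΛ : IsLeftIntegral Λ) : (desuspension hΛ).Additive :=
  inferInstanceAs (tensorRight _).Additive

instance iterate_additive (F : Comod k H ⥤ Comod k H) [F.Additive] : ∀ n, (iterate F n).Additive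
  | 0 => inferInstanceAs (𝟭 _).Additive
  | n + 1 =>
    have := iterate_additive F n
    inferInstanceAs (F ⋙ iterate F n).Additive

instance (Λ : H →ₗ[k] k) : (homologyZero Λ).Additive where
  map_add := by
    intros
    refine ModuleCat.hom_ext (LinearMap.ext fun x => ?_)
    obtain ⟨x, rfl⟩ := Submodule.mkQ_surjective _ x
    rfl

instance {Λ : H →ₗ[k] k} (hΛ : IsLeftIntegral Λ) : ∀ n, (homology hΛ n).Additive
  | Int.ofNat n => inferInstanceAs (iterate (desuspension hΛ) n ⋙ homologyZero Λ).Additive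
  | Int.negSucc n => inferInstanceAs (iterate (suspension k H) (n + 1) ⋙ homologyZero Λ).Additive

theorem descends_of_map_eq_zero {F : Comod k H ⥤ ModuleCat.{v} k} [F.Additive]
    (h : ∀ (M N : Comod k H) (f : M ⟶ N), FactorsThroughInjective f → F.map f = 0) :
    Descends F := fun M N f g hfg => by
  rw [← sub_eq_zero, ← F.map_sub, h _ _ _ hfg]

theorem Descends.map_eq_zero {F : Comod k H ⥤ ModuleCat.{v} k} [F.Additive] (hF : Descends F)
    {M N : Comod k H} (f : M ⟶ N) (h : FactorsThroughInjective f) : F.map f = 0 := by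
  rw [hF M N f 0 (by rwa [stableRel, sub_zero]), F.map_zero]

/-- On a coinvariant `m` the trace of `g` is `g(m)₀ Λ(g(m)₁ S(1)) = Λ · g(m)`, which is zero in the
quotient. -/
theorem IsLeftIntegral.homologyZero_map_eq_zero {Λ : H →ₗ[k] k} (hΛ : IsLeftIntegral Λ)
    (hne : Λ ≠ 0) {M N : Comod k H} (f : M ⟶ N) (hf : FactorsThroughInjective f) :
    (homologyZero Λ).map f = 0 := by
  obtain ⟨g, rfl⟩ := (hΛ.factorsThroughInjective_iff_trace hne f).1 hf
  refine ModuleCat.hom_ext (LinearMap.ext fun x => ?_)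
  obtain ⟨⟨m, hm⟩, rfl⟩ := Submodule.mkQ_surjective _ x
  refine (Submodule.Quotient.mk_eq_zero _).2 ?_
  change (hΛ.trace g).lin m ∈ LinearMap.range (integralAct Λ N)
  have hm' : M.coact m = m ⊗ₜ 1 := hm
  refine ⟨g m, ?_⟩
  rw [hΛ.trace_lin, hm', LinearMap.rTensor_tmul, average_tmul_coact]
  have : (pairing Λ).flip 1 = Λ := by ext; simp [HopfAlgebra.antipode_one]
  rw [this]

theorem IsLeftIntegral.homology_descends {Λ : H →ₗ[k] k} (hΛ : IsLeftIntegral Λ) (hne : Λ ≠ 0) :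
    ∀ n, Descends (homology hΛ n)
  | Int.ofNat n => descends_of_map_eq_zero fun _ _ f hf => hΛ.homologyZero_map_eq_zero hne _
      ((hΛ.desuspension_preservesStablyZero hne).iterate n f hf)
  | Int.negSucc n => descends_of_map_eq_zero fun _ _ f hf => hΛ.homologyZero_map_eq_zero hne _
      (suspension_preservesStablyZero.iterate (n + 1) f hf)

theorem Descends.isIso_map {F : Comod k H ⥤ ModuleCat.{v} k} (hF : Descends F)
    {M N : Comod k H} (f : M ⟶ N) [h : IsIso ((toStable k H).map f)] : IsIso (F.map f) :=
  inferInstanceAs (IsIso ((CategoryTheory.Quotient.lift _ F hF).map ((toStable k H).map f)))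

/-- The natural isomorphism `H_{n+1} ∘ T ≅ H_n`. -/
theorem IsLeftIntegral.nonempty_suspension_iso {Λ : H →ₗ[k] k} (hΛ : IsLeftIntegral Λ)
    (hne : Λ ≠ 0) : ∀ n : ℤ, Nonempty (suspension k H ⋙ homology hΛ (n + 1) ≅ homology hΛ n)
  | Int.ofNat n => by
    obtain ⟨α, hα⟩ := hΛ.exists_unit hne
    let F := homology hΛ (Int.ofNat n)
    let τ : F ⟶ (suspension k H ⋙ desuspension hΛ) ⋙ F := Functor.whiskerRight α F
    have h1 : ∀ M, IsIso (τ.app M) := fun M =>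
      have := hα M
      (hΛ.homology_descends hne (Int.ofNat n)).isIso_map (α.app M)
    have h2 : IsIso τ := NatIso.isIso_of_isIso_app τ
    -- The power `T'^(n+1)` begins with `T'`, so the target of `τ` is `H_{n+1} ∘ T` by definition.
    exact ⟨(asIso τ).symm⟩
  -- In negative degrees both sides unfold to the same power of `T` followed by `H_0`. Degree `-1`
  -- is separate because its successor leaves the `negSucc` branch.
  | Int.negSucc 0 => ⟨Iso.refl _⟩
  | Int.negSucc (n + 1) => ⟨Iso.refl _⟩

/-! ## Exactness -/

/-- `F` preserves short exact sequences. -/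
def PreservesShortExact (F : Comod k H ⥤ Comod k H) : Prop :=
  ∀ ⦃X Y Z : Comod k H⦄ (i : X ⟶ Y) (p : Y ⟶ Z), IsShortExact i p →
    IsShortExact (F.map i) (F.map p)

theorem PreservesShortExact.iterate {F : Comod k H ⥤ Comod k H} (hF : PreservesShortExact F) :
    ∀ n, PreservesShortExact (iterate F n)
  | 0 => fun _ _ _ _ _ h => h
  | n + 1 => fun _ _ _ _ _ h => PreservesShortExact.iterate hF n _ _ (hF _ _ h)

theorem tensorRight_preservesShortExact (P : Comod k H) : PreservesShortExact (tensorRight P) :=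
  fun _ _ _ i _ h =>
    ⟨Module.Flat.rTensor_preserves_injective_linearMap i.lin h.injective,
      Module.Flat.rTensor_exact P.carrier h.exact,
      LinearMap.rTensor_surjective P.carrier h.surjective⟩

theorem cokerπ_eq_zero_iff {M N : Comod k H} (f : M ⟶ N) (n : N.carrier) :
    (cokerπ f).lin n = 0 ↔ ∃ m, f.lin m = n :=
  Submodule.Quotient.mk_eq_zero _

theorem cokerπ_surjective {M N : Comod k H} (f : M ⟶ N) : Function.Surjective (cokerπ f).lin :=
  Submodule.mkQ_surjective _

theorem cokerπ_lin {M N : Comod k H} (f : M ⟶ N) (m : M.carrier) :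
    (cokerπ f).lin (f.lin m) = 0 :=
  (cokerπ_eq_zero_iff f _).2 ⟨m, rfl⟩

theorem suspMap_lin {M N : Comod k H} (f : M ⟶ N) (x : (cofree k H M.carrier).carrier) :
    (suspMap f).lin ((cokerπ M.coactHom).lin x) = (cokerπ N.coactHom).lin ((cofreeMap f).lin x) :=
  rfl

theorem cofreeMap_coactHom {M N : Comod k H} (f : M ⟶ N) (m : M.carrier) :
    (cofreeMap f).lin (M.coactHom.lin m) = N.coactHom.lin (f.lin m) :=
  congrArg (fun g => g.lin m) (coactHom_naturality f)

theorem isShortExact_cofreeMap {X Y Z : Comod k H} {i : X ⟶ Y} {p : Y ⟶ Z}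
    (h : IsShortExact i p) : IsShortExact (cofreeMap i) (cofreeMap p) :=
  ⟨Module.Flat.rTensor_preserves_injective_linearMap i.lin h.injective,
    Module.Flat.rTensor_exact H h.exact, LinearMap.rTensor_surjective H h.surjective⟩

/-- A hand-made nine lemma for the embeddings `ρ : M → M ⊗ H`. Injectivity of `ρ` on `Z` gives
injectivity of `T(i)`. -/
theorem suspension_preservesShortExact : PreservesShortExact (suspension k H) := by
  intro X Y Z i p h
  have hc := isShortExact_cofreeMap h
  refine ⟨?_, ?_, ?_⟩
  · refine (injective_iff_map_eq_zero (suspMap i).lin).2 fun t ht => ?_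
    obtain ⟨x, rfl⟩ := cokerπ_surjective _ t
    obtain ⟨y, hy⟩ := (cokerπ_eq_zero_iff _ _).1 ht
    have h0 : p.lin y = 0 := by
      apply coactHom_injective Z
      rw [← cofreeMap_coactHom, hy, map_zero]
      exact hc.exact.apply_apply_eq_zero x
    obtain ⟨m, rfl⟩ := (h.exact y).1 h0
    refine (cokerπ_eq_zero_iff _ _).2 ⟨m, hc.injective ?_⟩
    rw [cofreeMap_coactHom, hy]
  · intro t
    obtain ⟨x, rfl⟩ := cokerπ_surjective _ t
    constructor
    · intro ht
      obtain ⟨z, hz⟩ := (cokerπ_eq_zero_iff _ _).1 ht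
      obtain ⟨y, rfl⟩ := h.surjective z
      obtain ⟨u, hu⟩ := (hc.exact (x - Y.coactHom.lin y)).1 (by
        rw [map_sub, cofreeMap_coactHom, hz]
        exact sub_self _)
      refine ⟨(cokerπ X.coactHom).lin u, (suspMap_lin i u).trans ?_⟩
      rw [hu, map_sub, cokerπ_lin, sub_zero]
    · rintro ⟨s, hs⟩
      rw [← hs]
      have e : suspMap i ≫ suspMap p = 0 := by
        rw [← suspMap_comp, show i ≫ p = 0 from hom_ext h.exact.apply_apply_eq_zero]
        exact (suspension k H).map_zero _ _
      exact congrArg (fun g => g.lin s) e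
  · intro t
    obtain ⟨x, rfl⟩ := cokerπ_surjective _ t
    obtain ⟨y, rfl⟩ := hc.surjective x
    exact ⟨(cokerπ Y.coactHom).lin y, rfl⟩

/-- `F` is exact in the middle on short exact sequences. -/
def IsHalfExact (F : Comod k H ⥤ ModuleCat.{v} k) : Prop :=
  ∀ ⦃X Y Z : Comod k H⦄ (i : X ⟶ Y) (p : Y ⟶ Z), IsShortExact i p →
    Function.Exact (F.map i) (F.map p)

/-- If `p(y) = Λ · z`, lift `z` to `y'` and replace `y` by `y - Λ · y'`. This stays coinvariant, as
`Λ · Y` consists of coinvariants, and it now comes from `X`. -/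
theorem IsLeftIntegral.homologyZero_isHalfExact {Λ : H →ₗ[k] k} (hΛ : IsLeftIntegral Λ) :
    IsHalfExact (homologyZero Λ) := by
  intro X Y Z i p h t
  obtain ⟨⟨y, hy⟩, rfl⟩ := Submodule.mkQ_surjective _ t
  constructor
  · intro ht
    obtain ⟨z, hz⟩ : p.lin y ∈ LinearMap.range (integralAct Λ Z) :=
      (Submodule.Quotient.mk_eq_zero
        ((LinearMap.range (integralAct Λ Z)).submoduleOf (coinvariants Z))).1 ht
    obtain ⟨y', rfl⟩ := h.surjective z
    rw [← map_integralAct] at hz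
    obtain ⟨x, hx⟩ := (h.exact (y - integralAct Λ Y y')).1 (by rw [map_sub, hz, sub_self])
    have hx' : x ∈ coinvariants X := by
      apply Module.Flat.rTensor_preserves_injective_linearMap (M := H) i.lin h.injective
      have h1 : Y.coact (i.lin x) = i.lin x ⊗ₜ 1 := by
        rw [hx]
        exact (coinvariants Y).sub_mem hy (hΛ.integralAct_mem Y y')
      rw [i.colinear, h1]
      rfl
    refine ⟨Submodule.mkQ _ ⟨x, hx'⟩, ?_⟩
    refine (Submodule.Quotient.eq _).2 ?_
    refine ⟨-y', ?_⟩
    change integralAct Λ Y (-y') = i.lin x - y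
    rw [hx, map_neg]
    abel
  · rintro ⟨s, hs⟩
    rw [← hs]
    obtain ⟨⟨x, hx⟩, rfl⟩ := Submodule.mkQ_surjective _ s
    refine (Submodule.Quotient.mk_eq_zero _).2 ?_
    refine ⟨0, ?_⟩
    rw [map_zero]
    exact (h.exact.apply_apply_eq_zero x).symm

theorem IsLeftIntegral.homology_isHalfExact {Λ : H →ₗ[k] k} (hΛ : IsLeftIntegral Λ) :
    ∀ n, IsHalfExact (homology hΛ n)
  | Int.ofNat n => fun _ _ _ _ _ h => hΛ.homologyZero_isHalfExact _ _
      ((tensorRight_preservesShortExact (kerIntegral hΛ)).iterate n _ _ h)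
  | Int.negSucc n => fun _ _ _ _ _ h => hΛ.homologyZero_isHalfExact _ _
      (suspension_preservesShortExact.iterate (n + 1) _ _ h)

/-! ### The short exact sequences of a mapping cone -/

namespace Comod

/-- The projection onto the first summand. -/
def fst (M N : Comod k H) : prod M N ⟶ M := coprod (𝟙 M) 0

/-- The projection onto the second summand. -/
def snd (M N : Comod k H) : prod M N ⟶ N := coprod 0 (𝟙 N)

end Comod

variable {A B : Comod k H} (f : A ⟶ B)

theorem coneRel_lin (a : A.carrier) : (coneRel f).lin a =
    ((A.coactHom.lin a, -f.lin a) : (cofree k H A.carrier).carrier × B.carrier) :=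
  (sub_lin _ _ a).trans
    (Prod.ext (sub_zero (A.coactHom.lin a)) (zero_sub (f.lin a)))

theorem coneRel_injective : Function.Injective (coneRel f).lin := fun a b h => by
  rw [coneRel_lin, coneRel_lin] at h
  exact A.coactHom_injective (congrArg Prod.fst h)

theorem isShortExact_cone : IsShortExact (coneRel f) (cokerπ (coneRel f)) :=
  isShortExact_cokerπ _ (coneRel_injective f)

theorem cone_exists_rep (t : (cone f).carrier) :
    ∃ (u : (cofree k H A.carrier).carrier) (b : B.carrier),
      (cokerπ (coneRel f)).lin ((u, b) : _ × _) = t :=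
  let ⟨x, hx⟩ := cokerπ_surjective _ t
  ⟨x.1, x.2, hx⟩

theorem coneδ_lin (u : (cofree k H A.carrier).carrier) (b : B.carrier) :
    (coneδ f).lin ((cokerπ (coneRel f)).lin ((u, b) : _ × _)) = (cokerπ A.coactHom).lin u :=
  add_zero ((cokerπ A.coactHom).lin u)

theorem coneInr_comp_coneδ : coneInr f ≫ coneδ f = 0 := by
  rw [coneInr, coneδ, Category.assoc, cokerπ_desc, inr_coprod]

/-- Pushing out the monomorphism `ρ` along `f` preserves its injectivity and its cokernel `T(A)`. -/
theorem isShortExact_coneδ : IsShortExact (coneInr f) (coneδ f) := by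
  refine ⟨?_, fun t => ⟨fun ht => ?_, ?_⟩, fun t => ?_⟩
  · refine (injective_iff_map_eq_zero (coneInr f).lin).2 fun b hb => ?_
    obtain ⟨a, ha⟩ := (cokerπ_eq_zero_iff (coneRel f) _).1 hb
    rw [coneRel_lin] at ha
    have h1 : A.coactHom.lin a = 0 := congrArg Prod.fst ha
    have h2 : -f.lin a = b := congrArg Prod.snd ha
    have h3 : a = 0 := A.coactHom_injective (h1.trans (map_zero _).symm)
    rw [← h2, h3, map_zero, neg_zero]
  · obtain ⟨u, b, rfl⟩ := cone_exists_rep f t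
    rw [coneδ_lin] at ht
    obtain ⟨a, rfl⟩ := (cokerπ_eq_zero_iff _ _).1 ht
    refine ⟨b + f.lin a, ?_⟩
    have e : ((A.coactHom.lin a, b) : (cofree k H A.carrier).carrier × B.carrier) =
        (inr _ _ : B ⟶ prod (cofree k H A.carrier) B).lin (b + f.lin a) + (coneRel f).lin a := by
      rw [coneRel_lin]
      exact Prod.ext (zero_add _).symm (add_neg_cancel_right b (f.lin a)).symm
    rw [e]
    exact ((map_add _ _ _).trans ((congrArg _ (cokerπ_lin _ _)).trans (add_zero _))).symm
  · rintro ⟨b, rfl⟩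
    exact congrArg (fun g => g.lin b) (coneInr_comp_coneδ f)
  · obtain ⟨u, rfl⟩ := cokerπ_surjective _ t
    exact ⟨_, coneδ_lin f u 0⟩

/-- The map `Co(f) → T(A) ⊕ (B ⊗ H)`. -/
def coneToProd : cone f ⟶ prod (suspObj A) (cofree k H B.carrier) :=
  cokerDesc _ (coprod (cokerπ A.coactHom ≫ inl _ _ + cofreeMap f ≫ inr _ _)
    (B.coactHom ≫ inr _ _)) (coneRel_comp f _ _ (by
      rw [Preadditive.comp_add, ← Category.assoc, coker_condition, Limits.zero_comp, zero_add,
        ← Category.assoc, ← Category.assoc, coactHom_naturality]))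

/-- The map `T(A) ⊕ (B ⊗ H) → T(B)`. -/
def prodToSusp : prod (suspObj A) (cofree k H B.carrier) ⟶ suspObj B :=
  coprod (suspMap f) (-cokerπ B.coactHom)

theorem coneToProd_lin (u : (cofree k H A.carrier).carrier) (b : B.carrier) :
    (coneToProd f).lin ((cokerπ (coneRel f)).lin ((u, b) : _ × _)) =
      (((cokerπ A.coactHom).lin u, (cofreeMap f).lin u + B.coactHom.lin b) :
        (suspObj A).carrier × (cofree k H B.carrier).carrier) :=
  Prod.ext ((add_zero _).trans (add_zero _)) (congrArg (· + B.coactHom.lin b) (zero_add _))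

theorem prodToSusp_lin (t : (suspObj A).carrier) (w : (cofree k H B.carrier).carrier) :
    (prodToSusp f).lin ((t, w) : _ × _) = (suspMap f).lin t + -(cokerπ B.coactHom).lin w := rfl

/-- This presents `Co(f)` as the pullback of `T(f)` and the projection `B ⊗ H → T(B)`, which gives
exactness at `T(A)` without rotating triangles. -/
theorem isShortExact_coneToProd : IsShortExact (coneToProd f) (prodToSusp f) := by
  refine ⟨?_, fun t => ⟨fun ht => ?_, ?_⟩, fun t => ?_⟩
  · refine (injective_iff_map_eq_zero (coneToProd f).lin).2 fun t ht => ?_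
    obtain ⟨u, b, rfl⟩ := cone_exists_rep f t
    rw [coneToProd_lin] at ht
    have h1 : (cokerπ A.coactHom).lin u = 0 := congrArg Prod.fst ht
    have h2 : (cofreeMap f).lin u + B.coactHom.lin b = 0 := congrArg Prod.snd ht
    obtain ⟨a, rfl⟩ := (cokerπ_eq_zero_iff _ _).1 h1
    rw [cofreeMap_coactHom, ← map_add] at h2
    have h3 : f.lin a + b = 0 := B.coactHom_injective (h2.trans (map_zero _).symm)
    refine (cokerπ_eq_zero_iff _ _).2 ⟨a, ?_⟩
    rw [coneRel_lin, neg_eq_of_add_eq_zero_right h3]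
  · obtain ⟨t, w⟩ := (t : (suspObj A).carrier × (cofree k H B.carrier).carrier)
    obtain ⟨u, rfl⟩ := cokerπ_surjective _ t
    rw [prodToSusp_lin, suspMap_lin, ← sub_eq_add_neg, ← map_sub] at ht
    obtain ⟨b, hb⟩ := (cokerπ_eq_zero_iff _ _).1 ht
    refine ⟨_, (coneToProd_lin f u (-b)).trans (Prod.ext rfl ?_)⟩
    change (cofreeMap f).lin u + B.coactHom.lin (-b) = w
    rw [map_neg, hb]
    abel
  · rintro ⟨t, rfl⟩
    obtain ⟨u, b, rfl⟩ := cone_exists_rep f t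
    rw [coneToProd_lin, prodToSusp_lin, suspMap_lin, map_add, cokerπ_lin, add_zero,
      add_neg_cancel]
  · obtain ⟨w, rfl⟩ := cokerπ_surjective _ t
    refine ⟨((0, -w) : _ × _), (prodToSusp_lin f 0 (-w)).trans ?_⟩
    rw [map_zero, map_neg, neg_neg, zero_add]

/-! ### Exact sequences of a mapping cone -/

section

variable {F : Comod k H ⥤ ModuleCat.{v} k}

theorem IsHalfExact.exact_coneδ (hF : IsHalfExact F) :
    Function.Exact (F.map (coneInr f)) (F.map (coneδ f)) :=
  hF _ _ (isShortExact_coneδ f)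

variable [F.Additive]

/-- Include a class killed in the cone into `(A ⊗ H) ⊕ B`, lift it to `A`, and project back to `B`;
the sign in `(ρ, -f)` is absorbed by `-a`. Conversely, `A → Co(f)` passes through `A ⊗ H`. -/
theorem IsHalfExact.exact_coneInr (hF : IsHalfExact F) (hd : Descends F) :
    Function.Exact (F.map f) (F.map (coneInr f)) := by
  intro y
  constructor
  · intro hy
    obtain ⟨a, ha⟩ := (hF _ _ (isShortExact_cone f) (F.map (inr _ _) y)).1 (by
      rw [← ConcreteCategory.comp_apply, ← F.map_comp]
      exact hy)
    have e : coneRel f ≫ snd _ _ = -f := by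
      rw [coneRel, snd, Preadditive.sub_comp, Category.assoc, Category.assoc, inl_coprod,
        inr_coprod, Limits.comp_zero, zero_sub, Category.comp_id]
    refine ⟨-a, ?_⟩
    have h1 := congrArg (F.map (snd _ _)) ha
    rw [← ConcreteCategory.comp_apply, ← ConcreteCategory.comp_apply, ← F.map_comp, ← F.map_comp,
      e, snd, inr_coprod, F.map_id, F.map_neg] at h1
    rw [map_neg]
    exact h1
  · rintro ⟨a, rfl⟩
    rw [← ConcreteCategory.comp_apply, ← F.map_comp,
      hd.map_eq_zero (f ≫ coneInr f) ⟨_, cofree_injective _, A.coactHom, coneInl f,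
        (cone_isPushout f).w⟩]
    rfl

theorem coneδ_comp_suspMap :
    coneδ f ≫ suspMap f = (coneToProd f ≫ snd _ _) ≫ cokerπ B.coactHom := by
  ext t
  obtain ⟨u, b, rfl⟩ := cone_exists_rep f t
  have h : (snd _ _).lin ((coneToProd f).lin ((cokerπ (coneRel f)).lin ((u, b) : _ × _))) =
      (cofreeMap f).lin u + B.coactHom.lin b := by
    rw [coneToProd_lin]
    exact zero_add _
  rw [comp_lin, comp_lin, comp_lin, h, coneδ_lin, suspMap_lin, map_add, cokerπ_lin, add_zero]

theorem coneToProd_fst : coneToProd f ≫ fst _ _ = coneδ f := by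
  ext t
  obtain ⟨u, b, rfl⟩ := cone_exists_rep f t
  rw [comp_lin, coneToProd_lin, coneδ_lin]
  exact add_zero ((cokerπ A.coactHom).lin u)

/-- The same device with the summand `B ⊗ H`: lift the class included from `T(A)` to the cone, then
project. The composite to `T(B)` passes through `B ⊗ H`. -/
theorem IsHalfExact.exact_suspMap (hF : IsHalfExact F) (hd : Descends F) :
    Function.Exact (F.map (coneδ f)) (F.map (suspMap f)) := by
  intro t
  constructor
  · intro ht
    obtain ⟨c, hc⟩ := (hF _ _ (isShortExact_coneToProd f) (F.map (inl _ _) t)).1 (by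
      rw [← ConcreteCategory.comp_apply, ← F.map_comp, prodToSusp, inl_coprod]
      exact ht)
    refine ⟨c, ?_⟩
    have h1 := congrArg (F.map (fst _ _)) hc
    rw [← ConcreteCategory.comp_apply, ← ConcreteCategory.comp_apply, ← F.map_comp, ← F.map_comp,
      coneToProd_fst, fst, inl_coprod, F.map_id] at h1
    exact h1
  · rintro ⟨a, rfl⟩
    rw [← ConcreteCategory.comp_apply, ← F.map_comp,
      hd.map_eq_zero (coneδ f ≫ suspMap f) ⟨_, cofree_injective _, coneToProd f ≫ snd _ _,
        cokerπ B.coactHom, (coneδ_comp_suspMap f).symm⟩]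
    rfl

end

/-! ### Transport to triangles in the stable category -/

theorem exact_of_iso {X Y Z X' Y' Z' : ModuleCat.{v} k} {f : X ⟶ Y} {g : Y ⟶ Z} {f' : X' ⟶ Y'}
    {g' : Y' ⟶ Z'} (a : X ≅ X') (b : Y ≅ Y') (c : Z ≅ Z') (hf : f ≫ b.hom = a.hom ≫ f')
    (hg : g ≫ c.hom = b.hom ≫ g') (h : Function.Exact f' g') : Function.Exact f g :=
  (Function.Exact.iff_of_ladder_linearEquiv (e₁ := a.toLinearEquiv) (e₂ := b.toLinearEquiv)
    (e₃ := c.toLinearEquiv) (f₁₂ := f.hom) (f₂₃ := g.hom) (g₁₂ := f'.hom) (g₂₃ := g'.hom)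
    (congrArg ModuleCat.Hom.hom hf).symm (congrArg ModuleCat.Hom.hom hg).symm).1 h

/-- The natural isomorphism `H_{n+1} ∘ T ≅ H_n` on the stable category. -/
theorem IsLeftIntegral.nonempty_stableSuspension_iso {Λ : H →ₗ[k] k} (hΛ : IsLeftIntegral Λ)
    (hne : Λ ≠ 0) (hdesc : ∀ n : ℤ, Descends (homology hΛ n)) (n : ℤ) :
    Nonempty (stableSuspension k H ⋙ stableHomology hΛ hdesc (n + 1) ≅
      stableHomology hΛ hdesc n) := by
  obtain ⟨e⟩ := hΛ.nonempty_suspension_iso hne n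
  exact ⟨CategoryTheory.Quotient.natIsoLift _
    (NatIso.ofComponents (fun M => e.app M) fun g => e.hom.naturality g)⟩

end CoFrobenius

end

theorem mainTheorem2 {k : Type u} {H : Type v} [Field k] [Ring H] [HopfAlgebra k H]
    (Λ : H →ₗ[k] k) (hΛ : CoFrobenius.IsLeftIntegral Λ) (hne : Λ ≠ 0) :
    ∃ hdesc : ∀ n : ℤ, CoFrobenius.Descends (CoFrobenius.homology hΛ n),
      (∀ n : ℤ, (CoFrobenius.stableHomology hΛ hdesc n).Additive) ∧
      ∃ θ : ∀ n : ℤ, CoFrobenius.stableSuspension k H ⋙ CoFrobenius.stableHomology hΛ hdesc (n + 1) ≅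
          CoFrobenius.stableHomology hΛ hdesc n,
        ∀ (X Y Z : CoFrobenius.Stable k H) (f : X ⟶ Y) (g : Y ⟶ Z)
          (h : Z ⟶ (CoFrobenius.stableSuspension k H).obj X), CoFrobenius.IsTriangle f g h →
          ∀ n : ℤ,
            Function.Exact ((CoFrobenius.stableHomology hΛ hdesc n).map f)
              ((CoFrobenius.stableHomology hΛ hdesc n).map g) ∧
            Function.Exact ((CoFrobenius.stableHomology hΛ hdesc (n + 1)).map g)
              ((CoFrobenius.stableHomology hΛ hdesc (n + 1)).map h ≫ (θ n).hom.app X) ∧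
            Function.Exact
              ((CoFrobenius.stableHomology hΛ hdesc (n + 1)).map h ≫ (θ n).hom.app X)
              ((CoFrobenius.stableHomology hΛ hdesc n).map f) := by
  have hdesc := hΛ.homology_descends hne
  -- Any choice of natural isomorphisms will do: exactness uses only naturality and invertibility,
  -- with no compatibility between degrees.
  let θ (n : ℤ) := (hΛ.nonempty_stableSuspension_iso hne hdesc n).some
  refine ⟨hdesc, fun n => ⟨?_⟩, θ, ?_⟩
  · rintro ⟨M⟩ ⟨N⟩ ⟨f⟩ ⟨g⟩
    exact (CoFrobenius.homology hΛ n).map_add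
  · rintro X Y Z f g h ⟨A, B, f₀, a, b, c, hf, hg, hh⟩ n
    let G := CoFrobenius.stableHomology hΛ hdesc
    let T := CoFrobenius.stableSuspension k H
    have hE := fun m => hΛ.homology_isHalfExact m
    -- This identifies degree `n` at `W` with degree `n + 1` at `T(W')`, so the end of the sequence
    -- can be read off from `Co(f₀) → T(A) → T(B)` in degree `n + 1`.
    let e {W W' : CoFrobenius.Stable k H} (i : W ≅ W') :
        (G n).obj W ≅ (G (n + 1)).obj (T.obj W') :=
      ((θ n).app W).symm ≪≫ (G (n + 1)).mapIso (T.mapIso i)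
    have sq1 (m : ℤ) : (G m).map g ≫ ((G m).mapIso c).hom =
        ((G m).mapIso b).hom ≫ (CoFrobenius.homology hΛ m).map (CoFrobenius.coneInr f₀) := by
      refine ((G m).map_comp _ _).symm.trans ?_
      rw [hg, Functor.map_comp]
      rfl
    have sq2 : ((G (n + 1)).map h ≫ (θ n).hom.app X) ≫ (e a).hom =
        ((G (n + 1)).mapIso c).hom ≫
          (CoFrobenius.homology hΛ (n + 1)).map (CoFrobenius.coneδ f₀) := by
      have h1 : ((G (n + 1)).map h ≫ (θ n).hom.app X) ≫ (e a).hom =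
          (G (n + 1)).map (h ≫ T.map a.hom) := by
        simp [e]
      rw [h1, hh, Functor.map_comp]
      rfl
    -- Naturality of `θ` turns the map induced by `f` in degree `n` into the one induced by `T(f₀)`
    -- in degree `n + 1`.
    have sq3 : (G n).map f ≫ (e b).hom = (e a).hom ≫
        (CoFrobenius.homology hΛ (n + 1)).map (CoFrobenius.suspMap f₀) := by
      have h1 : (G n).map f ≫ (e b).hom =
          (θ n).inv.app X ≫ (G (n + 1)).map (T.map (f ≫ b.hom)) := by
        have := (θ n).inv.naturality f
        simp only [e, Iso.trans_hom, Iso.symm_hom, Iso.app_inv, Functor.mapIso_hom,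
          Functor.map_comp]
        rw [← Category.assoc, this, Category.assoc]
        rfl
      rw [h1, hf, Functor.map_comp, Functor.map_comp, ← Category.assoc]
      rfl
    refine ⟨?_, ?_, ?_⟩
    · refine CoFrobenius.exact_of_iso ((G n).mapIso a) ((G n).mapIso b) ((G n).mapIso c) ?_ (sq1 n)
        ((hE n).exact_coneInr f₀ (hdesc n))
      refine ((G n).map_comp _ _).symm.trans ?_
      rw [hf, Functor.map_comp]
      rfl
    · exact CoFrobenius.exact_of_iso ((G (n + 1)).mapIso b) ((G (n + 1)).mapIso c) (e a)
        (sq1 (n + 1)) sq2 ((hE (n + 1)).exact_coneδ f₀)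
    · exact CoFrobenius.exact_of_iso ((G (n + 1)).mapIso c) (e a) (e b) sq2 sq3
        ((hE (n + 1)).exact_suspMap f₀ (hdesc (n + 1)))
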